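/- Let $M$ be a smooth $n$-dimensional manifold with a smooth pseudo-Riemannian metric $g$ (of any signature). A semicolon denotes covariant differentiation with respect to the Levi-Civita connection of $g$, indices are raised and lowered with $g$, and the Riemann curvature $R$ is normalised by $A_{c;ba}-A_{c;ab}=R_{abc}{}^{d}A_d$ for one-forms $A$. Let $W=T^*M\oplus\Lambda^2T^*M$; write its sections as $X=K+L$ with $K=K_a$ a one-form and $L=L_{ab}$ a skew-symmetric $2$-tensor, and give $W$ the connection $$\nabla_iX=(K_{a;i}-L_{ai})+(L_{ab;i}-R_{abi}{}^{c}K_c).$$ For $U\subseteq M$ open, let $\mathcal K_U$ be the space of Killing fields on $U$, i.e. smooth one-forms $K$ on $U$ with $K_{a;b}+K_{b;a}=0$, with the bracket that corresponds under $g$ to the Lie bracket of vector fields, and let $\mathcal P_U$ be the space of smooth parallel sections of $W$ over $U$. Define $\phi_U(K)=K_a+K_{a;b}$ for $K\in\mathcal K_U$, and, for $x\in U$, $r_x(X)=X(x)$ and $W_{U,x}=\{X(x): X\in\mathcal P_U\}\subseteq W_x$. On $W_x=T_x^*M\oplus\Lambda^2T_x^*M$ consider the bracket $$[K+L,K'+L']=\bigl(L'_{ab}K^b-L_{ab}K'^b\bigr)+\bigl(L'_a{}^{c}L_{cb}-L_a{}^{c}L'_{cb}+R_{abcd}K^cK'^d\bigr),$$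 with $R=R_x$ and indices raised with $g_x$. Lemma. Let $U\subseteq M$ be open and connected and let $x\in U$. Then $\phi_U$ maps $\mathcal K_U$ into $\mathcal P_U$; $\mathcal K_U$ is a Lie algebra; $W_{U,x}$ is closed under the bracket above, which satisfies the Jacobi identity on it, so that it becomes a Lie algebra $\mathcal A(W_{U,x},R_x,g_x)$; and $$r_x\circ\phi_U:\mathcal K_U\longrightarrow\mathcal A(W_{U,x},R_x,g_x),\qquad K\mapsto K_a(x)+K_{a;b}(x),$$ is an isomorphism of Lie algebras. -/

import Mathlib

set_option maxSynthPendingDepth 3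
set_option linter.unusedSectionVars false

open scoped Manifold ContDiff Bundle

noncomputable section

namespace KillingFields

/-! ### The algebra `𝒜(𝒲, B, h)` -/

section Algebra

variable {V : Type*} [AddCommGroup V] [Module ℝ V] [TopologicalSpace V]
  [IsTopologicalAddGroup V] [ContinuousSMul ℝ V]

/-- Evaluation of linear maps at a fixed vector. -/
def evalCLM (F : Type*) [AddCommGroup F] [Module ℝ F] [TopologicalSpace F]
    [IsTopologicalAddGroup F] [ContinuousSMul ℝ F] (k : V) : (V →L[ℝ] F) →L[ℝ] F where
  toFun f := f k
  map_add' _ _ := rfl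
  map_smul' _ _ := rfl
  cont := continuous_eval_const k

/-- The bilinear form `(a, b) ↦ B(a, b, k, k')`. -/
def contractLast (B : V →L[ℝ] V →L[ℝ] V →L[ℝ] V →L[ℝ] ℝ) (k k' : V) : V →L[ℝ] V →L[ℝ] ℝ :=
  (ContinuousLinearMap.postcomp V ((evalCLM ℝ k').comp (evalCLM (V →L[ℝ] ℝ) k))).comp B

theorem contractLast_apply (B : V →L[ℝ] V →L[ℝ] V →L[ℝ] V →L[ℝ] ℝ) (k k' a b : V) :
    contractLast B k k' a b = B a b k k' := rfl

/-- The bracket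
`[K + L, K' + L'] = L'_{ab} K^b - L_{ab} K'^b
  + L'_a{}^c L_{cb} - L_a{}^c L'_{cb} + B_{abcd} K^c K'^d`,
where indices are raised with `h`. -/
def tensorBracket (B : V →L[ℝ] V →L[ℝ] V →L[ℝ] V →L[ℝ] ℝ) (h : V →L[ℝ] V →L[ℝ] ℝ)
    (X X' : (V →L[ℝ] ℝ) × (V →L[ℝ] V →L[ℝ] ℝ)) :
    (V →L[ℝ] ℝ) × (V →L[ℝ] V →L[ℝ] ℝ) :=
  ((evalCLM ℝ (h.inverse X.1)).comp X'.2 - (evalCLM ℝ (h.inverse X'.1)).comp X.2,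
    X.2.comp (h.inverse.comp X'.2) - X'.2.comp (h.inverse.comp X.2)
      + contractLast B (h.inverse X.1) (h.inverse X'.1))

end Algebra

/-! ### Subspaces on which a bracket is a Lie bracket -/

section LieOn

variable {P : Type*} [AddCommGroup P] [Module ℝ P]

/-- The operation `br` restricts to a Lie bracket on the subspace `S`. -/
structure IsLieBracketOn (br : P → P → P) (S : Submodule ℝ P) : Prop where
  mem : ∀ X ∈ S, ∀ Y ∈ S, br X Y ∈ S
  add_left : ∀ X ∈ S, ∀ Y ∈ S, ∀ Z ∈ S, br (X + Y) Z = br X Z + br Y Z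
  smul_left : ∀ c : ℝ, ∀ X ∈ S, ∀ Y ∈ S, br (c • X) Y = c • br X Y
  add_right : ∀ X ∈ S, ∀ Y ∈ S, ∀ Z ∈ S, br X (Y + Z) = br X Y + br X Z
  smul_right : ∀ c : ℝ, ∀ X ∈ S, ∀ Y ∈ S, br X (c • Y) = c • br X Y
  self : ∀ X ∈ S, br X X = 0
  jacobi : ∀ X ∈ S, ∀ Y ∈ S, ∀ Z ∈ S, br X (br Y Z) + br Y (br Z X) + br Z (br X Y) = 0

variable {br : P → P → P} {S : Submodule ℝ P}

/-- The Lie algebra with underlying vector space `S` and bracket `br`. -/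
def IsLieBracketOn.LieAlg (_ : IsLieBracketOn br S) : Type _ := S

instance (h : IsLieBracketOn br S) : AddCommGroup h.LieAlg :=
  inferInstanceAs (AddCommGroup S)

instance (h : IsLieBracketOn br S) : Module ℝ h.LieAlg :=
  inferInstanceAs (Module ℝ S)

/-- The element of the ambient vector space underlying an element of the Lie algebra. -/
def IsLieBracketOn.val (h : IsLieBracketOn br S) (X : h.LieAlg) : P := Subtype.val (p := (· ∈ S)) X

theorem IsLieBracketOn.neg_swap (h : IsLieBracketOn br S) {X Y : P} (hX : X ∈ S) (hY : Y ∈ S) :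
    br X Y = -br Y X := by
  have h1 := h.self (X + Y) (S.add_mem hX hY)
  rw [h.add_left X hX Y hY _ (S.add_mem hX hY), h.add_right X hX X hX Y hY,
    h.add_right Y hY X hX Y hY, h.self X hX, h.self Y hY, zero_add, add_zero] at h1
  exact eq_neg_of_add_eq_zero_left h1

instance (h : IsLieBracketOn br S) : LieRing h.LieAlg where
  bracket X Y := (⟨br (h.val X) (h.val Y), h.mem _ X.2 _ Y.2⟩ : S)
  add_lie X Y Z := Subtype.ext (h.add_left _ X.2 _ Y.2 _ Z.2)
  lie_add X Y Z := Subtype.ext (h.add_right _ X.2 _ Y.2 _ Z.2)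
  lie_self X := Subtype.ext (h.self _ X.2)
  leibniz_lie X Y Z := Subtype.ext (by
    change br (h.val X) (br (h.val Y) (h.val Z)) =
      br (br (h.val X) (h.val Y)) (h.val Z) + br (h.val Y) (br (h.val X) (h.val Z))
    have hX : h.val X ∈ S := X.2
    have hY : h.val Y ∈ S := Y.2
    have hZ : h.val Z ∈ S := Z.2
    have hYZX : br (h.val Y) (br (h.val Z) (h.val X)) = -br (h.val Y) (br (h.val X) (h.val Z)) := by
      rw [h.neg_swap hZ hX, ← neg_one_smul ℝ (br (h.val X) (h.val Z)),
        h.smul_right (-1) _ hY _ (h.mem _ hX _ hZ), neg_one_smul]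
    have hJ := h.jacobi _ hX _ hY _ hZ
    rw [hYZX, h.neg_swap hZ (h.mem _ hX _ hY)] at hJ
    have h2 := eq_neg_of_add_eq_zero_left hJ
    rw [neg_neg] at h2
    rw [← h2]
    abel)

instance (h : IsLieBracketOn br S) : LieAlgebra ℝ h.LieAlg where
  lie_smul c X Y := Subtype.ext (h.smul_right c _ X.2 _ Y.2)

theorem IsLieBracketOn.val_lie (h : IsLieBracketOn br S) (X Y : h.LieAlg) :
    h.val ⁅X, Y⁆ = br (h.val X) (h.val Y) := rfl

end LieOn

/-! ### Tensor calculus in coordinates -/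

section Coordinates

variable {E : Type*} [NormedAddCommGroup E] [NormedSpace ℝ E]

/-- Christoffel symbols of the first kind of a metric `G`, given by its coordinate components. -/
def christoffelLower (G : E → E →L[ℝ] E →L[ℝ] ℝ) (y : E) : E →L[ℝ] E →L[ℝ] E →L[ℝ] ℝ :=
  (2⁻¹ : ℝ) • (fderiv ℝ G y + (fderiv ℝ G y).flip
    - (ContinuousLinearMap.flipₗᵢ ℝ E E ℝ).toContinuousLinearEquiv.toContinuousLinearMap.comp
        (fderiv ℝ G y).flip)

theorem christoffelLower_apply (G : E → E →L[ℝ] E →L[ℝ] ℝ) (y u v w : E) :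
    christoffelLower G y u v w =
      2⁻¹ * (fderiv ℝ G y u v w + fderiv ℝ G y v u w - fderiv ℝ G y w u v) := rfl

/-- Christoffel symbols `Γ(u, v)` of the Levi-Civita connection of `G`. -/
def christoffel (G : E → E →L[ℝ] E →L[ℝ] ℝ) (y : E) : E →L[ℝ] E →L[ℝ] E :=
  (ContinuousLinearMap.postcomp E (G y).inverse).comp (christoffelLower G y)

theorem christoffel_apply (G : E → E →L[ℝ] E →L[ℝ] ℝ) (y u v : E) :
    christoffel G y u v = (G y).inverse (christoffelLower G y u v) := rfl

/-- The covariant derivative `K_{a;b}` of a one-form; the second argument is the direction of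
differentiation. -/
def covDerivForm (G : E → E →L[ℝ] E →L[ℝ] ℝ) (K : E → E →L[ℝ] ℝ) (y : E) : E →L[ℝ] E →L[ℝ] ℝ :=
  (fderiv ℝ K y - (ContinuousLinearMap.postcomp E (K y)).comp (christoffel G y)).flip

theorem covDerivForm_apply (G : E → E →L[ℝ] E →L[ℝ] ℝ) (K : E → E →L[ℝ] ℝ) (y a b : E) :
    covDerivForm G K y a b = fderiv ℝ K y b a - K y (christoffel G y b a) := rfl

/-- The covariant derivative `L_{ab;i}` of a covariant 2-tensor. -/
def covDerivBilin (G : E → E →L[ℝ] E →L[ℝ] ℝ) (L : E → E →L[ℝ] E →L[ℝ] ℝ) (y a b i : E) : ℝ :=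
  fderiv ℝ L y i a b - L y (christoffel G y i a) b - L y a (christoffel G y i b)

theorem covDerivForm_add (G : E → E →L[ℝ] E →L[ℝ] ℝ) {K K' : E → E →L[ℝ] ℝ} {y : E}
    (hK : DifferentiableAt ℝ K y) (hK' : DifferentiableAt ℝ K' y) (a b : E) :
    covDerivForm G (K + K') y a b = covDerivForm G K y a b + covDerivForm G K' y a b := by
  simp only [covDerivForm_apply, fderiv_add hK hK', Pi.add_apply, add_apply]
  ring

theorem covDerivForm_smul (G : E → E →L[ℝ] E →L[ℝ] ℝ) {K : E → E →L[ℝ] ℝ} {y : E} (c : ℝ)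
    (hK : DifferentiableAt ℝ K y) (a b : E) :
    covDerivForm G (c • K) y a b = c * covDerivForm G K y a b := by
  simp only [covDerivForm_apply, fderiv_const_smul hK, Pi.smul_apply, smul_apply, smul_eq_mul]
  ring

theorem covDerivBilin_add (G : E → E →L[ℝ] E →L[ℝ] ℝ) {L L' : E → E →L[ℝ] E →L[ℝ] ℝ} {y : E}
    (hL : DifferentiableAt ℝ L y) (hL' : DifferentiableAt ℝ L' y) (a b i : E) :
    covDerivBilin G (L + L') y a b i = covDerivBilin G L y a b i + covDerivBilin G L' y a b i := by
  simp only [covDerivBilin, fderiv_add hL hL', Pi.add_apply, add_apply]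
  ring

theorem covDerivBilin_smul (G : E → E →L[ℝ] E →L[ℝ] ℝ) {L : E → E →L[ℝ] E →L[ℝ] ℝ} {y : E}
    (c : ℝ) (hL : DifferentiableAt ℝ L y) (a b i : E) :
    covDerivBilin G (c • L) y a b i = c * covDerivBilin G L y a b i := by
  simp only [covDerivBilin, fderiv_const_smul hL, Pi.smul_apply, smul_apply, smul_eq_mul]
  ring

/-- The curvature `R_{abc}{}^d`, as the map `(a, b, c) ↦ R(a, b, c) ∈ E`, with the sign convention
`A_{c;ba} - A_{c;ab} = R_{abc}{}^d A_d` for one-forms `A`. -/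
def curvature (G : E → E →L[ℝ] E →L[ℝ] ℝ) (y : E) : E →L[ℝ] E →L[ℝ] E →L[ℝ] E :=
  (fderiv ℝ (christoffel G) y
      + (ContinuousLinearMap.compL ℝ E E E).bilinearComp (christoffel G y) (christoffel G y)).flip
    - (fderiv ℝ (christoffel G) y
      + (ContinuousLinearMap.compL ℝ E E E).bilinearComp (christoffel G y) (christoffel G y))

theorem curvature_apply (G : E → E →L[ℝ] E →L[ℝ] ℝ) (y a b c : E) :
    curvature G y a b c =
      (fderiv ℝ (christoffel G) y b a c + christoffel G y b (christoffel G y a c))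
      - (fderiv ℝ (christoffel G) y a b c + christoffel G y a (christoffel G y b c)) := rfl

/-- The curvature with all indices lowered, `R_{abcd}`. -/
def curvatureLower (G : E → E →L[ℝ] E →L[ℝ] ℝ) (y : E) :
    E →L[ℝ] E →L[ℝ] E →L[ℝ] E →L[ℝ] ℝ :=
  (ContinuousLinearMap.postcomp E (ContinuousLinearMap.postcomp E (G y))).comp (curvature G y)

theorem curvatureLower_apply (G : E → E →L[ℝ] E →L[ℝ] ℝ) (y a b c d : E) :
    curvatureLower G y a b c d = G y (curvature G y a b c) d := rfl

/-- The `T^*M`-component `K_{a;i} - L_{ai}` of the connection on `T^*M ⊕ Λ²T^*M`. -/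
def connForm (G : E → E →L[ℝ] E →L[ℝ] ℝ) (K : E → E →L[ℝ] ℝ) (L : E → E →L[ℝ] E →L[ℝ] ℝ)
    (y a i : E) : ℝ :=
  covDerivForm G K y a i - L y a i

/-- The `Λ²T^*M`-component `L_{ab;i} - R_{abi}{}^c K_c` of the connection on `T^*M ⊕ Λ²T^*M`. -/
def connBilin (G : E → E →L[ℝ] E →L[ℝ] ℝ) (K : E → E →L[ℝ] ℝ) (L : E → E →L[ℝ] E →L[ℝ] ℝ)
    (y a b i : E) : ℝ :=
  covDerivBilin G L y a b i - K y (curvature G y a b i)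

end Coordinates

/-! ### Pullback of tensors along a linear map -/

section Pullback

variable {V W : Type*} [AddCommGroup V] [Module ℝ V] [TopologicalSpace V]
  [IsTopologicalAddGroup V] [ContinuousSMul ℝ V]
  [AddCommGroup W] [Module ℝ W] [TopologicalSpace W]
  [IsTopologicalAddGroup W] [ContinuousSMul ℝ W]

/-- Pullback of a bilinear form. -/
def pullBilin (D : V →L[ℝ] W) (L : W →L[ℝ] W →L[ℝ] ℝ) : V →L[ℝ] V →L[ℝ] ℝ :=
  (ContinuousLinearMap.precomp ℝ D).comp (L.comp D)

theorem pullBilin_apply (D : V →L[ℝ] W) (L : W →L[ℝ] W →L[ℝ] ℝ) (a b : V) :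
    pullBilin D L a b = L (D a) (D b) := rfl

/-- Pullback of a covariant 4-tensor. -/
def pullQuad (D : V →L[ℝ] W) (B : W →L[ℝ] W →L[ℝ] W →L[ℝ] W →L[ℝ] ℝ) :
    V →L[ℝ] V →L[ℝ] V →L[ℝ] V →L[ℝ] ℝ :=
  (ContinuousLinearMap.precomp (V →L[ℝ] V →L[ℝ] ℝ) D).comp
    (((ContinuousLinearMap.postcomp W ((ContinuousLinearMap.precomp (V →L[ℝ] ℝ) D).comp
      (ContinuousLinearMap.postcomp W (ContinuousLinearMap.precomp ℝ D)))).comp B).comp D)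

theorem pullQuad_apply (D : V →L[ℝ] W) (B : W →L[ℝ] W →L[ℝ] W →L[ℝ] W →L[ℝ] ℝ) (a b c d : V) :
    pullQuad D B a b c d = B (D a) (D b) (D c) (D d) := rfl

end Pullback

/-! ### Pseudo-Riemannian manifolds -/

section Manifold

variable {E : Type*} [NormedAddCommGroup E] [NormedSpace ℝ E]
  {M : Type*} [TopologicalSpace M] [ChartedSpace E M]

/-- The cotangent space at `p`. -/
abbrev Cotangent (E : Type*) [NormedAddCommGroup E] [NormedSpace ℝ E]
    {M : Type*} [TopologicalSpace M] [ChartedSpace E M] (p : M) : Type _ :=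
  TangentSpace 𝓘(ℝ, E) p →L[ℝ] ℝ

/-- Covariant 2-tensors at `p`. -/
abbrev Bilin (E : Type*) [NormedAddCommGroup E] [NormedSpace ℝ E]
    {M : Type*} [TopologicalSpace M] [ChartedSpace E M] (p : M) : Type _ :=
  TangentSpace 𝓘(ℝ, E) p →L[ℝ] TangentSpace 𝓘(ℝ, E) p →L[ℝ] ℝ

/-- The one-form `K` is smooth on the open set `U`. -/
def SmoothFormOn [IsManifold 𝓘(ℝ, E) ∞ M] (K : ∀ p : M, Cotangent E p) (U : Set M) : Prop :=
  ContMDiffOn 𝓘(ℝ, E) (𝓘(ℝ, E).prod 𝓘(ℝ, E →L[ℝ] ℝ)) ∞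
    (fun p ↦ Bundle.TotalSpace.mk' (E →L[ℝ] ℝ) p (K p)) U

/-- The covariant 2-tensor `L` is smooth on the open set `U`. -/
def SmoothBilinOn [IsManifold 𝓘(ℝ, E) ∞ M] (L : ∀ p : M, Bilin E p) (U : Set M) : Prop :=
  ContMDiffOn 𝓘(ℝ, E) (𝓘(ℝ, E).prod 𝓘(ℝ, E →L[ℝ] E →L[ℝ] ℝ)) ∞
    (fun p ↦ Bundle.TotalSpace.mk' (E →L[ℝ] E →L[ℝ] ℝ) p (L p)) U

variable (E M) in
/-- A smooth pseudo-Riemannian metric on `M`, of arbitrary signature. -/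
structure PseudoRiemannianMetric [IsManifold 𝓘(ℝ, E) ∞ M] where
  val : ∀ p : M, Bilin E p
  symm : ∀ (p : M) (v w : TangentSpace 𝓘(ℝ, E) p), val p v w = val p w v
  nondegenerate : ∀ (p : M) (v : TangentSpace 𝓘(ℝ, E) p), (∀ w, val p v w = 0) → v = 0
  smooth : SmoothBilinOn val Set.univ

/-- The differential at `p` of a chart. -/
def chartDeriv (e : OpenPartialHomeomorph M E) (p : M) : TangentSpace 𝓘(ℝ, E) p →L[ℝ] E :=
  mfderiv 𝓘(ℝ, E) 𝓘(ℝ, E) e p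

/-- The differential at `y` of the inverse of a chart. -/
def chartSymmDeriv (e : OpenPartialHomeomorph M E) (y : E) :
    E →L[ℝ] TangentSpace 𝓘(ℝ, E) (e.symm y) :=
  mfderiv 𝓘(ℝ, E) 𝓘(ℝ, E) e.symm y

/-- The coordinate components of a one-form in a chart. -/
def formInChart (e : OpenPartialHomeomorph M E) (K : ∀ p : M, Cotangent E p) (y : E) :
    E →L[ℝ] ℝ :=
  (K (e.symm y)).comp (chartSymmDeriv e y)

/-- The coordinate components of a covariant 2-tensor in a chart. -/
def bilinInChart (e : OpenPartialHomeomorph M E) (L : ∀ p : M, Bilin E p) (y : E) :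
    E →L[ℝ] E →L[ℝ] ℝ :=
  pullBilin (chartSymmDeriv e y) (L (e.symm y))

/-! #### Smooth tensors have smooth coordinate components -/

section Smoothness

variable [FiniteDimensional ℝ E] [IsManifold 𝓘(ℝ, E) ∞ M]

theorem contMDiffAt_chartSymmDeriv {e : OpenPartialHomeomorph M E}
    (he : e ∈ IsManifold.maximalAtlas 𝓘(ℝ, E) ∞ M) {y : E} (hy : y ∈ e.target) (u : E) :
    ContMDiffAt 𝓘(ℝ, E) (𝓘(ℝ, E).prod 𝓘(ℝ, E)) ∞
      (fun z ↦ Bundle.TotalSpace.mk' E (E := (TangentSpace 𝓘(ℝ, E) : M → Type _))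
        (e.symm z) (chartSymmDeriv e z u)) y := by
  have : IsManifold 𝓘(ℝ, E) 1 M := .of_le (n := ∞) (by simp)
  have h1 := (contMDiffOn_symm_of_mem_maximalAtlas he).contMDiffOn_tangentMapWithin
    (m := ∞) (by simp) e.open_target.uniqueMDiffOn
  have h2 : ContMDiffAt 𝓘(ℝ, E) (𝓘(ℝ, E).prod 𝓘(ℝ, E)) ∞
      (fun z : E ↦ (⟨z, u⟩ : TangentBundle 𝓘(ℝ, E) E)) y := by
    exact contMDiffAt_vectorSpace_iff_contDiffAt (V := fun _ ↦ u) |>.2 contDiffAt_const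
  have h3 := (h1 ⟨y, u⟩ hy).comp_of_eq (s := e.target) h2.contMDiffWithinAt (fun z hz ↦ hz) rfl
  refine (h3.contMDiffAt (e.open_target.mem_nhds hy)).congr_of_eventuallyEq ?_
  filter_upwards [e.open_target.mem_nhds hy] with z hz
  simp only [Function.comp_apply, tangentMapWithin, chartSymmDeriv,
    mfderivWithin_of_isOpen e.open_target hz]
  rfl

theorem isOpen_chartDomain (e : OpenPartialHomeomorph M E) {U : Set M} (hU : IsOpen U) :
    IsOpen (e.target ∩ e.symm ⁻¹' U) :=
  e.isOpen_inter_preimage_symm hU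

theorem SmoothFormOn.contDiffOn {K : ∀ p : M, Cotangent E p} {U : Set M} (hU : IsOpen U)
    (hK : SmoothFormOn K U) {e : OpenPartialHomeomorph M E}
    (he : e ∈ IsManifold.maximalAtlas 𝓘(ℝ, E) ∞ M) :
    ContDiffOn ℝ ∞ (formInChart e K) (e.target ∩ e.symm ⁻¹' U) := by
  rw [contDiffOn_clm_apply]
  intro u y hy
  have h1 : ContMDiffAt 𝓘(ℝ, E) (𝓘(ℝ, E).prod 𝓘(ℝ, E →L[ℝ] ℝ)) ∞
      (fun z ↦ Bundle.TotalSpace.mk' (E →L[ℝ] ℝ) (E := fun p : M ↦ Cotangent E p)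
        (e.symm z) (K (e.symm z))) y :=
    (hK.contMDiffAt (hU.mem_nhds hy.2)).comp y (contMDiffAt_symm_of_mem_maximalAtlas he hy.1)
  have h2 := ContMDiffAt.clm_bundle_apply (E₂ := Bundle.Trivial M ℝ) (F₂ := ℝ) h1
    (contMDiffAt_chartSymmDeriv he hy.1 u)
  rw [Bundle.contMDiffAt_totalSpace] at h2
  exact h2.2.contDiffAt.contDiffWithinAt

theorem SmoothBilinOn.contDiffOn {L : ∀ p : M, Bilin E p} {U : Set M} (hU : IsOpen U)
    (hL : SmoothBilinOn L U) {e : OpenPartialHomeomorph M E}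
    (he : e ∈ IsManifold.maximalAtlas 𝓘(ℝ, E) ∞ M) :
    ContDiffOn ℝ ∞ (bilinInChart e L) (e.target ∩ e.symm ⁻¹' U) := by
  rw [contDiffOn_clm_apply]
  intro u
  rw [contDiffOn_clm_apply]
  intro v y hy
  have h1 : ContMDiffAt 𝓘(ℝ, E) (𝓘(ℝ, E).prod 𝓘(ℝ, E →L[ℝ] E →L[ℝ] ℝ)) ∞
      (fun z ↦ Bundle.TotalSpace.mk' (E →L[ℝ] E →L[ℝ] ℝ) (E := fun p : M ↦ Bilin E p)
        (e.symm z) (L (e.symm z))) y :=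
    (hL.contMDiffAt (hU.mem_nhds hy.2)).comp y (contMDiffAt_symm_of_mem_maximalAtlas he hy.1)
  have h2 := ContMDiffAt.clm_bundle_apply₂ (E₂ := (TangentSpace 𝓘(ℝ, E) : M → Type _)) (F₂ := E)
    (E₃ := Bundle.Trivial M ℝ) (F₃ := ℝ) h1
    (contMDiffAt_chartSymmDeriv he hy.1 u) (contMDiffAt_chartSymmDeriv he hy.1 v)
  rw [Bundle.contMDiffAt_totalSpace] at h2
  exact h2.2.contDiffAt.contDiffWithinAt

theorem SmoothFormOn.differentiableAt {K : ∀ p : M, Cotangent E p} {U : Set M} (hU : IsOpen U)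
    (hK : SmoothFormOn K U) {e : OpenPartialHomeomorph M E}
    (he : e ∈ IsManifold.maximalAtlas 𝓘(ℝ, E) ∞ M) {y : E} (hy : y ∈ e.target)
    (hyU : e.symm y ∈ U) : DifferentiableAt ℝ (formInChart e K) y :=
  ((hK.contDiffOn hU he).differentiableOn (by simp)).differentiableAt
    ((isOpen_chartDomain e hU).mem_nhds ⟨hy, hyU⟩)

theorem SmoothBilinOn.differentiableAt {L : ∀ p : M, Bilin E p} {U : Set M} (hU : IsOpen U)
    (hL : SmoothBilinOn L U) {e : OpenPartialHomeomorph M E}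
    (he : e ∈ IsManifold.maximalAtlas 𝓘(ℝ, E) ∞ M) {y : E} (hy : y ∈ e.target)
    (hyU : e.symm y ∈ U) : DifferentiableAt ℝ (bilinInChart e L) y :=
  ((hL.contDiffOn hU he).differentiableOn (by simp)).differentiableAt
    ((isOpen_chartDomain e hU).mem_nhds ⟨hy, hyU⟩)

theorem SmoothFormOn.add {K K' : ∀ p : M, Cotangent E p} {U : Set M}
    (hK : SmoothFormOn K U) (hK' : SmoothFormOn K' U) : SmoothFormOn (K + K') U :=
  ContMDiffOn.add_section hK hK'

theorem SmoothFormOn.smul {K : ∀ p : M, Cotangent E p} {U : Set M} (c : ℝ)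
    (hK : SmoothFormOn K U) : SmoothFormOn (c • K) U :=
  ContMDiffOn.const_smul_section hK

theorem SmoothFormOn.zero {U : Set M} : SmoothFormOn (0 : ∀ p : M, Cotangent E p) U :=
  Bundle.contMDiffOn_zeroSection ℝ (fun p : M ↦ Cotangent E p)

theorem SmoothBilinOn.add {L L' : ∀ p : M, Bilin E p} {U : Set M}
    (hL : SmoothBilinOn L U) (hL' : SmoothBilinOn L' U) : SmoothBilinOn (L + L') U :=
  ContMDiffOn.add_section hL hL'

theorem SmoothBilinOn.smul {L : ∀ p : M, Bilin E p} {U : Set M} (c : ℝ)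
    (hL : SmoothBilinOn L U) : SmoothBilinOn (c • L) U :=
  ContMDiffOn.const_smul_section hL

theorem SmoothBilinOn.zero {U : Set M} : SmoothBilinOn (0 : ∀ p : M, Bilin E p) U :=
  Bundle.contMDiffOn_zeroSection ℝ (fun p : M ↦ Bilin E p)

theorem formInChart_add (e : OpenPartialHomeomorph M E) (K K' : ∀ p : M, Cotangent E p) :
    formInChart e (K + K') = formInChart e K + formInChart e K' := rfl

theorem formInChart_smul (e : OpenPartialHomeomorph M E) (c : ℝ) (K : ∀ p : M, Cotangent E p) :
    formInChart e (c • K) = c • formInChart e K := rfl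

theorem bilinInChart_add (e : OpenPartialHomeomorph M E) (L L' : ∀ p : M, Bilin E p) :
    bilinInChart e (L + L') = bilinInChart e L + bilinInChart e L' := rfl

theorem bilinInChart_smul (e : OpenPartialHomeomorph M E) (c : ℝ) (L : ∀ p : M, Bilin E p) :
    bilinInChart e (c • L) = c • bilinInChart e L := rfl

end Smoothness

/-! #### Killing fields, parallel sections and the comparison map

A section over the open set `U` is represented by its extension by zero to `M`. -/

section Fields

open TopologicalSpace (Opens)

variable [IsManifold 𝓘(ℝ, E) ∞ M]

/-- The Levi-Civita covariant derivative `K_{a;b}` at `p` of a one-form `K`, computed in the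
preferred chart at `p`; the second argument is the direction of differentiation. -/
def covDeriv (g : PseudoRiemannianMetric E M) (K : ∀ p : M, Cotangent E p) (p : M) : Bilin E p :=
  pullBilin (chartDeriv (chartAt E p) p)
    (covDerivForm (bilinInChart (chartAt E p) g.val) (formInChart (chartAt E p) K) (chartAt E p p))

/-- The Riemann curvature tensor `R_{abcd}` at `p`, computed in the preferred chart at `p`. -/
def riemann (g : PseudoRiemannianMetric E M) (p : M) :
    TangentSpace 𝓘(ℝ, E) p →L[ℝ] TangentSpace 𝓘(ℝ, E) p →L[ℝ] TangentSpace 𝓘(ℝ, E) p →L[ℝ]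
      TangentSpace 𝓘(ℝ, E) p →L[ℝ] ℝ :=
  pullQuad (chartDeriv (chartAt E p) p)
    (curvatureLower (bilinInChart (chartAt E p) g.val) (chartAt E p p))

/-- The vector field `K^a` obtained from the one-form `K_a` by raising the index. -/
def sharp (g : PseudoRiemannianMetric E M) (K : ∀ p : M, Cotangent E p) (p : M) :
    TangentSpace 𝓘(ℝ, E) p :=
  (g.val p).inverse (K p)

open Classical in
/-- The Lie bracket over `U` of two vector fields, both regarded as one-forms through `g`. -/
def fieldBracket (g : PseudoRiemannianMetric E M) (U : Opens M)
    (K K' : ∀ p : M, Cotangent E p) (p : M) : Cotangent E p :=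
  if p ∈ U then g.val p (VectorField.mlieBracket 𝓘(ℝ, E) (sharp g K) (sharp g K') p) else 0

open Classical in
/-- The map `φ_U : K_a ↦ K_a + K_{a;b}`. -/
def phi (g : PseudoRiemannianMetric E M) (U : Opens M) (K : ∀ p : M, Cotangent E p) (p : M) :
    Cotangent E p × Bilin E p :=
  if p ∈ U then (K p, covDeriv g K p) else 0

variable [FiniteDimensional ℝ E]

/-- The space `𝒦_U` of Killing fields on `U`: the smooth one-forms on `U` with
`K_{a;b} + K_{b;a} = 0` in every chart. -/
def killing (g : PseudoRiemannianMetric E M) (U : Opens M) :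
    Submodule ℝ (∀ p : M, Cotangent E p) where
  carrier := {K | SmoothFormOn K U ∧ (∀ p ∉ U, K p = 0) ∧
    ∀ e ∈ IsManifold.maximalAtlas 𝓘(ℝ, E) ∞ M, ∀ y ∈ e.target, e.symm y ∈ U → ∀ a b : E,
      covDerivForm (bilinInChart e g.val) (formInChart e K) y a b
        + covDerivForm (bilinInChart e g.val) (formInChart e K) y b a = 0}
  add_mem' {K K'} hK hK' := by
    refine ⟨hK.1.add hK'.1, fun p hp ↦ ?_, fun e he y hy hyU a b ↦ ?_⟩
    · rw [Pi.add_apply, hK.2.1 p hp, hK'.2.1 p hp, add_zero]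
    · have h := hK.2.2 e he y hy hyU a b
      have h' := hK'.2.2 e he y hy hyU a b
      have d := hK.1.differentiableAt U.isOpen he hy hyU
      have d' := hK'.1.differentiableAt U.isOpen he hy hyU
      rw [formInChart_add, covDerivForm_add _ d d', covDerivForm_add _ d d']
      linarith
  zero_mem' := by
    refine ⟨SmoothFormOn.zero, fun p _ ↦ rfl, fun e he y hy hyU a b ↦ ?_⟩
    have d := (SmoothFormOn.zero (E := E) (M := M)).differentiableAt U.isOpen he hy hyU
    have h0 : (0 : ∀ p : M, Cotangent E p) = (0 : ℝ) • 0 := (zero_smul ℝ _).symm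
    rw [h0, formInChart_smul, covDerivForm_smul _ _ d, covDerivForm_smul _ _ d]
    ring
  smul_mem' c K hK := by
    refine ⟨hK.1.smul c, fun p hp ↦ ?_, fun e he y hy hyU a b ↦ ?_⟩
    · rw [Pi.smul_apply, hK.2.1 p hp, smul_zero]
    · have h := hK.2.2 e he y hy hyU a b
      have d := hK.1.differentiableAt U.isOpen he hy hyU
      rw [formInChart_smul, covDerivForm_smul _ _ d, covDerivForm_smul _ _ d, ← mul_add, h,
        mul_zero]

/-- The space `𝒫_U` of parallel sections `X = K + L` over `U` of `W = T^*M ⊕ Λ²T^*M`: the smooth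
sections with `∇_i X = 0` in every chart. -/
def parallel (g : PseudoRiemannianMetric E M) (U : Opens M) :
    Submodule ℝ (∀ p : M, Cotangent E p × Bilin E p) where
  carrier := {X | SmoothFormOn (fun p ↦ (X p).1) U ∧ SmoothBilinOn (fun p ↦ (X p).2) U ∧
    (∀ p ∉ U, X p = 0) ∧
    (∀ p ∈ U, ∀ v w : TangentSpace 𝓘(ℝ, E) p, (X p).2 v w = -(X p).2 w v) ∧
    ∀ e ∈ IsManifold.maximalAtlas 𝓘(ℝ, E) ∞ M, ∀ y ∈ e.target, e.symm y ∈ U →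
      (∀ a i : E, connForm (bilinInChart e g.val) (formInChart e fun p ↦ (X p).1)
        (bilinInChart e fun p ↦ (X p).2) y a i = 0) ∧
      (∀ a b i : E, connBilin (bilinInChart e g.val) (formInChart e fun p ↦ (X p).1)
        (bilinInChart e fun p ↦ (X p).2) y a b i = 0)}
  add_mem' {X X'} hX hX' := by
    refine ⟨hX.1.add hX'.1, hX.2.1.add hX'.2.1, fun p hp ↦ ?_, fun p hp v w ↦ ?_,
      fun e he y hy hyU ↦ ?_⟩
    · rw [Pi.add_apply, hX.2.2.1 p hp, hX'.2.2.1 p hp, add_zero]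
    · have h := hX.2.2.2.1 p hp v w
      have h' := hX'.2.2.2.1 p hp v w
      simp only [Pi.add_apply, Prod.snd_add, add_apply, h, h']
      ring
    · obtain ⟨h1, h2⟩ := hX.2.2.2.2 e he y hy hyU
      obtain ⟨h1', h2'⟩ := hX'.2.2.2.2 e he y hy hyU
      have d := hX.1.differentiableAt U.isOpen he hy hyU
      have d' := hX'.1.differentiableAt U.isOpen he hy hyU
      have D := hX.2.1.differentiableAt U.isOpen he hy hyU
      have D' := hX'.2.1.differentiableAt U.isOpen he hy hyU
      have eK : (formInChart e fun p ↦ ((X + X') p).1)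
          = (formInChart e fun p ↦ (X p).1) + formInChart e fun p ↦ (X' p).1 := rfl
      have eL : (bilinInChart e fun p ↦ ((X + X') p).2)
          = (bilinInChart e fun p ↦ (X p).2) + bilinInChart e fun p ↦ (X' p).2 := rfl
      rw [eK, eL]
      refine ⟨fun a i ↦ ?_, fun a b i ↦ ?_⟩
      · have k := h1 a i
        have k' := h1' a i
        simp only [connForm, covDerivForm_add _ d d', Pi.add_apply, add_apply] at k k' ⊢
        linarith
      · have k := h2 a b i
        have k' := h2' a b i
        simp only [connBilin, covDerivBilin_add _ D D', Pi.add_apply, add_apply] at k k' ⊢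
        linarith
  zero_mem' := by
    refine ⟨SmoothFormOn.zero, SmoothBilinOn.zero, fun p _ ↦ rfl, fun p _ v w ↦ ?_,
      fun e he y hy hyU ↦ ?_⟩
    · simp
    · have eK : (formInChart e fun p ↦ ((0 : ∀ p : M, Cotangent E p × Bilin E p) p).1) = 0 := rfl
      have eL : (bilinInChart e fun p ↦ ((0 : ∀ p : M, Cotangent E p × Bilin E p) p).2) = 0 := by
        ext z u v
        rfl
      rw [eK, eL]
      refine ⟨fun a i ↦ ?_, fun a b i ↦ ?_⟩
      · simp [connForm, covDerivForm_apply]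
      · simp [connBilin, covDerivBilin]
  smul_mem' c X hX := by
    refine ⟨hX.1.smul c, hX.2.1.smul c, fun p hp ↦ ?_, fun p hp v w ↦ ?_,
      fun e he y hy hyU ↦ ?_⟩
    · rw [Pi.smul_apply, hX.2.2.1 p hp, smul_zero]
    · have h := hX.2.2.2.1 p hp v w
      simp only [Pi.smul_apply, Prod.smul_snd, smul_apply, h, smul_neg]
    · obtain ⟨h1, h2⟩ := hX.2.2.2.2 e he y hy hyU
      have d := hX.1.differentiableAt U.isOpen he hy hyU
      have D := hX.2.1.differentiableAt U.isOpen he hy hyU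
      have eK : (formInChart e fun p ↦ ((c • X) p).1) = c • formInChart e fun p ↦ (X p).1 := rfl
      have eL : (bilinInChart e fun p ↦ ((c • X) p).2) = c • bilinInChart e fun p ↦ (X p).2 := rfl
      rw [eK, eL]
      refine ⟨fun a i ↦ ?_, fun a b i ↦ ?_⟩
      · have k := h1 a i
        simp only [connForm, covDerivForm_smul _ _ d, Pi.smul_apply, smul_apply,
          smul_eq_mul] at k ⊢
        rw [← mul_sub, k, mul_zero]
      · have k := h2 a b i
        simp only [connBilin, covDerivBilin_smul _ _ D, Pi.smul_apply, smul_apply,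
          smul_eq_mul] at k ⊢
        rw [← mul_sub, k, mul_zero]

/-- The subspace `W_{U,x}` of `W_x` of values at `x` of parallel sections over `U`. -/
def parallelValues (g : PseudoRiemannianMetric E M) (U : Opens M) (x : M) :
    Submodule ℝ (Cotangent E x × Bilin E x) :=
  (parallel g U).map (LinearMap.proj x)

theorem mem_parallelValues (g : PseudoRiemannianMetric E M) (U : Opens M) (x : M)
    (w : Cotangent E x × Bilin E x) :
    w ∈ parallelValues g U x ↔ ∃ X ∈ parallel g U, X x = w := Iff.rfl

end Fields

end Manifold

end KillingFields

end

/-!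
The map `φ_U` is inverse to taking the one-form component of a parallel section. If `K` is a
Killing field then `L_{ab} = K_{a;b}` is skew, and the Ricci identity, used three times together
with the first Bianchi identity, gives `L_{ab;i} = R_{abi}{}^c K_c`
(`IsKillingOn.connBilin_eq_zero`), so that `K + L` is parallel. Conversely the one-form component of
a parallel section is a Killing field, because `K_{a;i} = L_{ai}` is skew
(`exists_killing_of_mem_parallel`). A parallel section solves a linear first-order equation, so by
Grönwall's inequality its zero set is open; being also relatively closed, it is all of a connected
set as soon as it is non-empty (`eq_zero_of_mem_parallel`). Hence evaluation at `x` is a linear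
bijection from the Killing fields onto the values of parallel sections (`evalPhi_bijective`).

For the brackets, vanishing torsion turns the Lie bracket of vector fields into the one-form
`L'_{ab} K^b - L_{ab} K'^b`. Differentiating it covariantly, and using that `K + L` and `K' + L'`
are parallel and the pair symmetry of the curvature, gives exactly the `Λ²`-component of the
algebraic bracket (`IsMetricOn.covDerivForm_lieBracket`). This component is skew, so the bracket of
Killing fields is Killing, and `φ_U` intertwines the two brackets (`phi_fieldBracket`). The Jacobi
identity for the algebraic bracket is then inherited from that of vector fields
(`IsLieBracketOn.of_surjective`).

All tensor identities are proved in coordinates, for a metric on an open subset of `E`. The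
transformation law of the Christoffel symbols is not needed: for a Killing field, `K_{a;b}` is half
of the exterior derivative of `K`, which is compatible with changes of charts
(`bilinInChart_covDeriv`).
-/

namespace KillingFields

open Set Filter
open scoped Topology
open TopologicalSpace (Opens)

/-! ### The Levi-Civita connection and its curvature in coordinates -/

section CoordinateGeometry

variable {E : Type*} [NormedAddCommGroup E] [NormedSpace ℝ E]

theorem isInvertible_of_nondegenerate [FiniteDimensional ℝ E] {h : E →L[ℝ] E →L[ℝ] ℝ}
    (hh : ∀ v, (∀ w, h v w = 0) → v = 0) : h.IsInvertible := by
  have hinj : Function.Injective (h : E →ₗ[ℝ] E →L[ℝ] ℝ) := by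
    rw [injective_iff_map_eq_zero]
    exact fun v hv ↦ hh v fun w ↦ by
      have := congrArg (fun f : E →L[ℝ] ℝ ↦ f w) hv
      exact this
  have hfin : Module.finrank ℝ E = Module.finrank ℝ (E →L[ℝ] ℝ) := by
    rw [← (LinearMap.toContinuousLinearMap (𝕜 := ℝ) (E := E) (F' := ℝ)).finrank_eq]
    exact Subspace.dual_finrank_eq.symm
  exact ⟨(LinearEquiv.ofInjectiveOfFinrankEq (h : E →ₗ[ℝ] E →L[ℝ] ℝ) hinj
    hfin).toContinuousLinearEquiv, by ext; rfl⟩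

theorem fderiv_apply_const {F : Type*} [NormedAddCommGroup F] [NormedSpace ℝ F]
    {f : E → E →L[ℝ] F} {y : E} (hf : DifferentiableAt ℝ f y) (u v : E) :
    fderiv ℝ (fun z ↦ f z u) y v = fderiv ℝ f y v u := by
  rw [fderiv_clm_apply hf (differentiableAt_const u)]
  simp

theorem fderiv_clm_apply_apply {F : Type*} [NormedAddCommGroup F] [NormedSpace ℝ F]
    {f : E → E →L[ℝ] F} {k : E → E} {y : E} (hf : DifferentiableAt ℝ f y)
    (hk : DifferentiableAt ℝ k y) (v : E) :
    fderiv ℝ (fun z ↦ f z (k z)) y v = fderiv ℝ f y v (k y) + f y (fderiv ℝ k y v) := by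
  rw [fderiv_clm_apply hf hk, add_comm]
  rfl

theorem fderiv_fderiv_comm {F : Type*} [NormedAddCommGroup F] [NormedSpace ℝ F]
    {f : E → F} {y : E} (hf : ContDiffAt ℝ ∞ f y) (u v : E) :
    fderiv ℝ (fderiv ℝ f) y u v = fderiv ℝ (fderiv ℝ f) y v u :=
  (hf.isSymmSndFDerivAt (by simpa using ENat.LEInfty.out)).eq u v

/-- `G` is the coordinate expression, over the open set `s`, of a smooth pseudo-Riemannian
metric; non-degeneracy is expressed as invertibility of the map that lowers indices. -/
structure IsMetricOn (G : E → E →L[ℝ] E →L[ℝ] ℝ) (s : Set E) : Prop where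
  isOpen : IsOpen s
  contDiffOn : ContDiffOn ℝ ∞ G s
  symm : ∀ z ∈ s, ∀ u v, G z u v = G z v u
  isInvertible : ∀ z ∈ s, (G z).IsInvertible

variable {G : E → E →L[ℝ] E →L[ℝ] ℝ} {s : Set E} {y : E}

theorem contDiffOn_fderiv {F : Type*} [NormedAddCommGroup F] [NormedSpace ℝ F] {f : E → F}
    (hs : IsOpen s) (hf : ContDiffOn ℝ ∞ f s) : ContDiffOn ℝ ∞ (fderiv ℝ f) s :=
  hf.fderiv_of_isOpen hs (by simp)

theorem differentiableAt_of_contDiffOn {F : Type*} [NormedAddCommGroup F] [NormedSpace ℝ F]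
    {f : E → F} (hs : IsOpen s) (hf : ContDiffOn ℝ ∞ f s) (hy : y ∈ s) : DifferentiableAt ℝ f y :=
  (hf.contDiffAt (hs.mem_nhds hy)).differentiableAt (by simp)

namespace IsMetricOn

theorem mono {t : Set E} (hG : IsMetricOn G s) (ht : IsOpen t) (hts : t ⊆ s) : IsMetricOn G t :=
  ⟨ht, hG.contDiffOn.mono hts, fun z hz ↦ hG.symm z (hts hz), fun z hz ↦ hG.isInvertible z (hts hz)⟩

theorem fderiv_symm (hG : IsMetricOn G s) (hy : y ∈ s) (w u v : E) :
    fderiv ℝ G y w u v = fderiv ℝ G y w v u := by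
  have hd := differentiableAt_of_contDiffOn hG.isOpen hG.contDiffOn hy
  have hd' : ∀ u, DifferentiableAt ℝ (fun z ↦ G z u) y := fun u ↦ hd.clm_apply (by simp)
  rw [← fderiv_apply_const hd, ← fderiv_apply_const hd, ← fderiv_apply_const (hd' u),
    ← fderiv_apply_const (hd' v)]
  congr 1
  apply Filter.EventuallyEq.fderiv_eq
  filter_upwards [hG.isOpen.mem_nhds hy] with z hz using hG.symm z hz u v

theorem metric_christoffel (hG : IsMetricOn G s) (hy : y ∈ s) (u v w : E) :
    G y (christoffel G y u v) w = christoffelLower G y u v w := by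
  rw [christoffel_apply, (hG.isInvertible y hy).self_apply_inverse]

theorem ext_metric (hG : IsMetricOn G s) (hy : y ∈ s) {u v : E} (h : ∀ w, G y u w = G y v w) :
    u = v :=
  (hG.isInvertible y hy).injective (ContinuousLinearMap.ext h)

theorem christoffel_symm (hG : IsMetricOn G s) (hy : y ∈ s) (u v : E) :
    christoffel G y u v = christoffel G y v u := by
  refine hG.ext_metric hy fun w ↦ ?_
  rw [hG.metric_christoffel hy, hG.metric_christoffel hy, christoffelLower_apply,
    christoffelLower_apply, hG.fderiv_symm hy w u v]
  ring

/-- Compatibility of the connection with the metric. -/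
theorem fderiv_metric (hG : IsMetricOn G s) (hy : y ∈ s) (w u v : E) :
    fderiv ℝ G y w u v = G y (christoffel G y w u) v + G y u (christoffel G y w v) := by
  rw [hG.symm y hy u, hG.metric_christoffel hy, hG.metric_christoffel hy, christoffelLower_apply,
    christoffelLower_apply, hG.fderiv_symm hy w v u, hG.fderiv_symm hy v w u,
    hG.fderiv_symm hy u w v]
  ring

theorem contDiffOn_inverse [FiniteDimensional ℝ E] (hG : IsMetricOn G s) :
    ContDiffOn ℝ ∞ (fun z ↦ (G z).inverse) s := fun z hz ↦
  have : CompleteSpace E := FiniteDimensional.complete ℝ E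
  (hG.isInvertible z hz).contDiffAt_map_inverse.comp_contDiffWithinAt z (hG.contDiffOn z hz)

variable [FiniteDimensional ℝ E]

theorem contDiffOn_christoffel (hG : IsMetricOn G s) : ContDiffOn ℝ ∞ (christoffel G) s := by
  have hd := contDiffOn_fderiv hG.isOpen hG.contDiffOn
  have hl : ContDiffOn ℝ ∞ (christoffelLower G) s := by
    simp only [contDiffOn_clm_apply, christoffelLower_apply]
    intro u v w
    have h : ∀ a b c, ContDiffOn ℝ ∞ (fun z ↦ fderiv ℝ G z a b c) s := fun a b c ↦
      ((hd.clm_apply contDiffOn_const).clm_apply contDiffOn_const).clm_apply contDiffOn_const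
    exact contDiffOn_const.mul (((h u v w).add (h v u w)).sub (h w u v))
  rw [contDiffOn_clm_apply]
  intro u
  rw [contDiffOn_clm_apply]
  intro v
  exact hG.contDiffOn_inverse.clm_apply
    ((hl.clm_apply contDiffOn_const).clm_apply contDiffOn_const)

theorem contDiffOn_curvature (hG : IsMetricOn G s) : ContDiffOn ℝ ∞ (curvature G) s := by
  have hΓ := hG.contDiffOn_christoffel
  have hd := contDiffOn_fderiv hG.isOpen hΓ
  simp only [contDiffOn_clm_apply, curvature_apply]
  intro a b c
  have h1 : ∀ a b, ContDiffOn ℝ ∞ (fun z ↦ fderiv ℝ (christoffel G) z a b c) s := fun a b ↦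
    ((hd.clm_apply contDiffOn_const).clm_apply contDiffOn_const).clm_apply contDiffOn_const
  have h2 : ∀ a b, ContDiffOn ℝ ∞ (fun z ↦ christoffel G z a (christoffel G z b c)) s := fun a b ↦
    (hΓ.clm_apply contDiffOn_const).clm_apply
      ((hΓ.clm_apply contDiffOn_const).clm_apply contDiffOn_const)
  exact ((h1 b a).add (h2 b a)).sub ((h1 a b).add (h2 a b))

theorem fderiv_christoffel_symm (hG : IsMetricOn G s) (hy : y ∈ s) (w u v : E) :
    fderiv ℝ (christoffel G) y w u v = fderiv ℝ (christoffel G) y w v u := by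
  have hd := differentiableAt_of_contDiffOn hG.isOpen hG.contDiffOn_christoffel hy
  have hd' : ∀ u, DifferentiableAt ℝ (fun z ↦ christoffel G z u) y := fun u ↦
    hd.clm_apply (by simp)
  rw [← fderiv_apply_const hd, ← fderiv_apply_const hd, ← fderiv_apply_const (hd' u),
    ← fderiv_apply_const (hd' v)]
  congr 1
  apply Filter.EventuallyEq.fderiv_eq
  filter_upwards [hG.isOpen.mem_nhds hy] with z hz using hG.christoffel_symm hz u v

theorem curvature_swap (G : E → E →L[ℝ] E →L[ℝ] ℝ) (y a b c : E) :
    curvature G y b a c = -curvature G y a b c := by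
  rw [curvature_apply, curvature_apply, neg_sub]

/-- The first Bianchi identity. -/
theorem curvature_bianchi (hG : IsMetricOn G s) (hy : y ∈ s) (a b c : E) :
    curvature G y a b c + curvature G y b c a + curvature G y c a b = 0 := by
  simp only [curvature_apply]
  rw [hG.fderiv_christoffel_symm hy a c b, hG.fderiv_christoffel_symm hy b c a,
    hG.fderiv_christoffel_symm hy c b a, hG.christoffel_symm hy c b, hG.christoffel_symm hy a c,
    hG.christoffel_symm hy b a]
  abel

/-- Differentiating the compatibility of the connection with the metric. -/
theorem fderiv_fderiv_metric (hG : IsMetricOn G s) (hy : y ∈ s) (x w u v : E) :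
    fderiv ℝ (fderiv ℝ G) y x w u v =
      fderiv ℝ G y x (christoffel G y w u) v + G y (fderiv ℝ (christoffel G) y x w u) v
      + (fderiv ℝ G y x u (christoffel G y w v) + G y u (fderiv ℝ (christoffel G) y x w v)) := by
  have hd := differentiableAt_of_contDiffOn hG.isOpen hG.contDiffOn hy
  have hdd := differentiableAt_of_contDiffOn hG.isOpen (contDiffOn_fderiv hG.isOpen hG.contDiffOn)
    hy
  have hΓ := differentiableAt_of_contDiffOn hG.isOpen hG.contDiffOn_christoffel hy
  have hΓ1 : ∀ u, DifferentiableAt ℝ (fun z ↦ christoffel G z u) y := fun u ↦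
    hΓ.clm_apply (by simp)
  have hΓ2 : ∀ u v, DifferentiableAt ℝ (fun z ↦ christoffel G z u v) y := fun u v ↦
    (hΓ1 u).clm_apply (by simp)
  have hd1 : ∀ u, DifferentiableAt ℝ (fun z ↦ G z u) y := fun u ↦ hd.clm_apply (by simp)
  have hdd1 : ∀ u, DifferentiableAt ℝ (fun z ↦ fderiv ℝ G z u) y := fun u ↦ hdd.clm_apply (by simp)
  have hdd2 : ∀ u v, DifferentiableAt ℝ (fun z ↦ fderiv ℝ G z u v) y := fun u v ↦
    (hdd1 u).clm_apply (by simp)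
  have hGΓ : DifferentiableAt ℝ (fun z ↦ G z (christoffel G z w u)) y := hd.clm_apply (hΓ2 w u)
  have key : fderiv ℝ (fun z ↦ fderiv ℝ G z w u v) y = fderiv ℝ (fun z ↦
      G z (christoffel G z w u) v + G z u (christoffel G z w v)) y := by
    apply Filter.EventuallyEq.fderiv_eq
    filter_upwards [hG.isOpen.mem_nhds hy] with z hz using hG.fderiv_metric hz w u v
  have key' := congrArg (fun f : E →L[ℝ] ℝ ↦ f x) key
  beta_reduce at key'
  rw [fderiv_apply_const (hdd2 w u), fderiv_apply_const (hdd1 w), fderiv_apply_const hdd,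
    fderiv_fun_add (hGΓ.clm_apply (by simp)) ((hd1 u).clm_apply (hΓ2 w v)), add_apply,
    fderiv_apply_const hGΓ, fderiv_clm_apply_apply hd (hΓ2 w u),
    fderiv_clm_apply_apply (hd1 u) (hΓ2 w v), fderiv_apply_const hd,
    fderiv_apply_const (hΓ1 w), fderiv_apply_const (hΓ1 w), fderiv_apply_const hΓ,
    add_apply] at key'
  exact key'

theorem curvatureLower_swap_left (G : E → E →L[ℝ] E →L[ℝ] ℝ) (y a b c d : E) :
    curvatureLower G y b a c d = -curvatureLower G y a b c d := by
  simp only [curvatureLower_apply, curvature_swap G y a b c, map_neg, neg_apply]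

/-- Skewness in the last two indices: antisymmetrise the second derivative of the metric, which is
symmetric. The products of two Christoffel symbols that pair both slots of `G` cancel. -/
theorem curvatureLower_swap_right (hG : IsMetricOn G s) (hy : y ∈ s) (a b c d : E) :
    curvatureLower G y a b d c = -curvatureLower G y a b c d := by
  have h1 := hG.fderiv_fderiv_metric hy a b c d
  have h2 := hG.fderiv_fderiv_metric hy b a c d
  rw [fderiv_fderiv_comm (hG.contDiffOn.contDiffAt (hG.isOpen.mem_nhds hy)) a b] at h1
  simp only [hG.fderiv_metric hy] at h1 h2
  simp only [curvatureLower_apply, curvature_apply, map_add, map_sub, add_apply, sub_apply]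
  rw [hG.symm y hy _ c, hG.symm y hy _ c, hG.symm y hy _ c, hG.symm y hy _ c]
  linarith

theorem curvatureLower_bianchi (hG : IsMetricOn G s) (hy : y ∈ s) (a b c d : E) :
    curvatureLower G y a b c d + curvatureLower G y b c a d + curvatureLower G y c a b d = 0 := by
  have h := congrArg (fun u ↦ G y u d) (hG.curvature_bianchi hy a b c)
  simpa only [map_add, add_apply, map_zero, zero_apply, curvatureLower_apply] using h

theorem curvatureLower_pair_symm (hG : IsMetricOn G s) (hy : y ∈ s) (a b c d : E) :
    curvatureLower G y a b c d = curvatureLower G y c d a b := by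
  -- pair symmetry follows from the four instances of the Bianchi identity (octahedron argument)
  have h1 := hG.curvatureLower_bianchi hy a b c d
  have h2 := hG.curvatureLower_bianchi hy b c d a
  have h3 := hG.curvatureLower_bianchi hy c d a b
  have h4 := hG.curvatureLower_bianchi hy d a b c
  have l := curvatureLower_swap_left G y
  have r := hG.curvatureLower_swap_right hy
  linarith [l a b c d, r a b c d, l b c a d, r b c a d, l c a b d, r c a b d, l b c d a, r b c d a,
    l c d b a, r c d b a, l d b c a, r d b c a, l c d a b, r c d a b, l d a c b, r d a c b,
    l a c d b, r a c d b, l d a b c, r d a b c, l a b d c, r a b d c, l b d a c, r b d a c,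
    r a b d c, r b d c a, r a c b d]

end IsMetricOn
end CoordinateGeometry

/-! ### Killing fields in coordinates -/

section CoordinateKilling

variable {E : Type*} [NormedAddCommGroup E] [NormedSpace ℝ E] [FiniteDimensional ℝ E]
  {G : E → E →L[ℝ] E →L[ℝ] ℝ} {s : Set E} {y : E}

/-- The smooth one-form `K` satisfies the Killing equation over `s`. -/
structure IsKillingOn (G : E → E →L[ℝ] E →L[ℝ] ℝ) (K : E → E →L[ℝ] ℝ) (s : Set E) : Prop where
  contDiffOn : ContDiffOn ℝ ∞ K s
  killing : ∀ z ∈ s, ∀ a b, covDerivForm G K z a b + covDerivForm G K z b a = 0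

theorem IsMetricOn.contDiffOn_covDerivForm (hG : IsMetricOn G s) {K : E → E →L[ℝ] ℝ}
    (hK : ContDiffOn ℝ ∞ K s) : ContDiffOn ℝ ∞ (covDerivForm G K) s := by
  have hΓ := hG.contDiffOn_christoffel
  have hd := contDiffOn_fderiv hG.isOpen hK
  simp only [contDiffOn_clm_apply, covDerivForm_apply]
  intro a b
  exact ((hd.clm_apply contDiffOn_const).clm_apply contDiffOn_const).sub
    (hK.clm_apply ((hΓ.clm_apply contDiffOn_const).clm_apply contDiffOn_const))

namespace IsKillingOn

variable {K K' : E → E →L[ℝ] ℝ}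

theorem covDerivForm_skew (hK : IsKillingOn G K s) (hy : y ∈ s) (a b : E) :
    covDerivForm G K y a b = -covDerivForm G K y b a :=
  eq_neg_of_add_eq_zero_left (hK.killing y hy a b)

/-- The skewness of `K_{a;b}` holds on an open set, so it may be differentiated. -/
theorem fderiv_covDerivForm_skew (hK : IsKillingOn G K s) (hG : IsMetricOn G s) (hy : y ∈ s)
    (i a b : E) :
    fderiv ℝ (covDerivForm G K) y i a b = -fderiv ℝ (covDerivForm G K) y i b a := by
  have hd := differentiableAt_of_contDiffOn hG.isOpen (hG.contDiffOn_covDerivForm hK.contDiffOn) hy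
  have hd' : ∀ u, DifferentiableAt ℝ (fun z ↦ covDerivForm G K z u) y := fun u ↦
    hd.clm_apply (by simp)
  rw [← fderiv_apply_const hd, ← fderiv_apply_const hd, ← fderiv_apply_const (hd' a),
    ← fderiv_apply_const (hd' b), ← neg_apply, ← fderiv_fun_neg]
  congr 1
  apply Filter.EventuallyEq.fderiv_eq
  filter_upwards [hG.isOpen.mem_nhds hy] with z hz using hK.covDerivForm_skew hz a b

end IsKillingOn

/-- The Ricci identity `K_{a;bi} - K_{a;ib} = R_{iba}{}^c K_c`. -/
theorem IsMetricOn.covDerivBilin_covDerivForm_sub (hG : IsMetricOn G s) {K : E → E →L[ℝ] ℝ}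
    (hK : ContDiffOn ℝ ∞ K s) (hy : y ∈ s) (a b i : E) :
    covDerivBilin G (covDerivForm G K) y a b i - covDerivBilin G (covDerivForm G K) y a i b =
      K y (curvature G y i b a) := by
  have hL := differentiableAt_of_contDiffOn hG.isOpen (hG.contDiffOn_covDerivForm hK) hy
  have hKd := differentiableAt_of_contDiffOn hG.isOpen hK hy
  have hKdd := differentiableAt_of_contDiffOn hG.isOpen (contDiffOn_fderiv hG.isOpen hK) hy
  have hΓ := differentiableAt_of_contDiffOn hG.isOpen hG.contDiffOn_christoffel hy
  have hΓ1 : ∀ u, DifferentiableAt ℝ (fun z ↦ christoffel G z u) y := fun u ↦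
    hΓ.clm_apply (by simp)
  have hΓ2 : ∀ u v, DifferentiableAt ℝ (fun z ↦ christoffel G z u v) y := fun u v ↦
    (hΓ1 u).clm_apply (by simp)
  have hL1 : ∀ u, DifferentiableAt ℝ (fun z ↦ covDerivForm G K z u) y := fun u ↦
    hL.clm_apply (by simp)
  have hdd1 : ∀ u, DifferentiableAt ℝ (fun z ↦ fderiv ℝ K z u) y := fun u ↦ hKdd.clm_apply (by simp)
  have hderiv : ∀ a b i, fderiv ℝ (covDerivForm G K) y i a b = fderiv ℝ (fderiv ℝ K) y i b a
      - (fderiv ℝ K y i (christoffel G y b a) + K y (fderiv ℝ (christoffel G) y i b a)) := by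
    intro a b i
    rw [← fderiv_apply_const hL, ← fderiv_apply_const (hL1 a)]
    simp only [covDerivForm_apply]
    rw [fderiv_fun_sub ((hdd1 b).clm_apply (by simp)) (hKd.clm_apply (hΓ2 b a)), sub_apply,
      fderiv_apply_const (hdd1 b), fderiv_apply_const hKdd,
      fderiv_clm_apply_apply hKd (hΓ2 b a), fderiv_apply_const (hΓ1 b), fderiv_apply_const hΓ]
  simp only [covDerivBilin, hderiv, covDerivForm_apply, curvature_apply, map_add, map_sub]
  rw [fderiv_fderiv_comm (hK.contDiffAt (hG.isOpen.mem_nhds hy)) i b, hG.christoffel_symm hy i b]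
  ring

namespace IsKillingOn

variable {K K' : E → E →L[ℝ] ℝ}

/-- The second covariant derivative of a Killing field is determined by the curvature:
`K_{a;bi} = R_{abi}{}^c K_c`. -/
theorem connBilin_eq_zero (hK : IsKillingOn G K s) (hG : IsMetricOn G s) (hy : y ∈ s) (a b i : E) :
    connBilin G K (covDerivForm G K) y a b i = 0 := by
  have skew : ∀ a b i, covDerivBilin G (covDerivForm G K) y a b i =
      -covDerivBilin G (covDerivForm G K) y b a i := by
    intro a b i
    simp only [covDerivBilin, hK.fderiv_covDerivForm_skew hG hy i a b]
    rw [hK.covDerivForm_skew hy _ b, hK.covDerivForm_skew hy a _]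
    ring
  -- `K_{a;bi}` is skew in `a, b`, so the cyclic Ricci identities determine it
  have h1 := hG.covDerivBilin_covDerivForm_sub hK.contDiffOn hy a b i
  have h2 := hG.covDerivBilin_covDerivForm_sub hK.contDiffOn hy b i a
  have h3 := hG.covDerivBilin_covDerivForm_sub hK.contDiffOn hy i a b
  have hB := congrArg (K y) (hG.curvature_bianchi hy a b i)
  rw [map_add, map_add, map_zero] at hB
  have c1 := IsMetricOn.curvature_swap G y b i a
  have c2 := IsMetricOn.curvature_swap G y a b i
  have c3 := IsMetricOn.curvature_swap G y i a b
  rw [c1, map_neg] at h1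
  rw [c3, map_neg] at h2
  rw [c2, map_neg] at h3
  rw [connBilin]
  linarith [skew a b i, skew b i a, skew i a b]

end IsKillingOn

namespace IsMetricOn

variable {K K' : E → E →L[ℝ] ℝ} {k k' : E → E}

theorem contDiffOn_sharp (hG : IsMetricOn G s) (hK : ContDiffOn ℝ ∞ K s) :
    ContDiffOn ℝ ∞ (fun z ↦ (G z).inverse (K z)) s :=
  hG.contDiffOn_inverse.clm_apply hK

/-- Covariant differentiation commutes with lowering the index. -/
theorem covDerivForm_eq_metric (hG : IsMetricOn G s) (hk : ContDiffOn ℝ ∞ k s)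
    (hK : ∀ z ∈ s, K z = G z (k z)) (hy : y ∈ s) (a b : E) :
    covDerivForm G K y a b = G y (fderiv ℝ k y b + christoffel G y b (k y)) a := by
  have hd := differentiableAt_of_contDiffOn hG.isOpen hG.contDiffOn hy
  have hkd := differentiableAt_of_contDiffOn hG.isOpen hk hy
  have h : K =ᶠ[𝓝 y] fun z ↦ G z (k z) := by
    filter_upwards [hG.isOpen.mem_nhds hy] with z hz using hK z hz
  rw [covDerivForm_apply, h.fderiv_eq, fderiv_clm_apply_apply hd hkd, hK y hy, add_apply,
    hG.fderiv_metric hy, map_add, add_apply]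
  ring

/-- The one-form corresponding to the Lie bracket is `L'_{ab} K^b - L_{ab} K'^b`, where
`L_{ab} = K_{a;b}`, because the connection is torsion-free. -/
theorem metric_lieBracket (hG : IsMetricOn G s) (hk : ContDiffOn ℝ ∞ k s)
    (hk' : ContDiffOn ℝ ∞ k' s) (hK : ∀ z ∈ s, K z = G z (k z)) (hK' : ∀ z ∈ s, K' z = G z (k' z))
    (hy : y ∈ s) (a : E) :
    G y (VectorField.lieBracket ℝ k k' y) a =
      covDerivForm G K' y a (k y) - covDerivForm G K y a (k' y) := by
  rw [hG.covDerivForm_eq_metric hk hK hy, hG.covDerivForm_eq_metric hk' hK' hy,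
    VectorField.lieBracket, hG.christoffel_symm hy (k' y) (k y), ← sub_apply, ← map_sub]
  congr 2
  abel

/-- The one-form corresponding to the Lie bracket of two Killing fields, together with its covariant
derivative, is the algebraic bracket of the two pairs `K + L` with `L_{ab} = K_{a;b}`. -/
theorem covDerivForm_lieBracket (hG : IsMetricOn G s) (hKk : IsKillingOn G K s)
    (hKk' : IsKillingOn G K' s) (hk : ContDiffOn ℝ ∞ k s)
    (hk' : ContDiffOn ℝ ∞ k' s) (hK : ∀ z ∈ s, K z = G z (k z)) (hK' : ∀ z ∈ s, K' z = G z (k' z))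
    {B : E → E →L[ℝ] ℝ} (hB : ∀ z ∈ s, B z = G z (VectorField.lieBracket ℝ k k' z))
    (hBs : ContDiffOn ℝ ∞ B s) (hy : y ∈ s) :
    (B y, covDerivForm G B y) = tensorBracket (curvatureLower G y) (G y)
      (K y, covDerivForm G K y) (K' y, covDerivForm G K' y) := by
  have hinv : ∀ v, (G y).inverse (G y v) = v := (hG.isInvertible y hy).inverse_apply_self
  have hBL : ∀ z ∈ s, ∀ a, B z a = covDerivForm G K' z a (k z) - covDerivForm G K z a (k' z) := by
    intro z hz a
    rw [hB z hz, hG.metric_lieBracket hk hk' hK hK' hz]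
  refine Prod.ext ?_ ?_
  · ext a
    change B y a = covDerivForm G K' y a ((G y).inverse (K y))
      - covDerivForm G K y a ((G y).inverse (K' y))
    rw [hBL y hy, hK y hy, hK' y hy, hinv, hinv]
  · ext a c
    change covDerivForm G B y a c = covDerivForm G K y ((G y).inverse (covDerivForm G K' y a)) c
      - covDerivForm G K' y ((G y).inverse (covDerivForm G K y a)) c
      + curvatureLower G y a c ((G y).inverse (K y)) ((G y).inverse (K' y))
    have hkd := differentiableAt_of_contDiffOn hG.isOpen hk hy
    have hkd' := differentiableAt_of_contDiffOn hG.isOpen hk' hy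
    have hL := differentiableAt_of_contDiffOn hG.isOpen
      (hG.contDiffOn_covDerivForm hKk.contDiffOn) hy
    have hL' := differentiableAt_of_contDiffOn hG.isOpen
      (hG.contDiffOn_covDerivForm hKk'.contDiffOn) hy
    have hLa : DifferentiableAt ℝ (fun z ↦ covDerivForm G K z a) y := hL.clm_apply (by simp)
    have hLa' : DifferentiableAt ℝ (fun z ↦ covDerivForm G K' z a) y := hL'.clm_apply (by simp)
    have h : (fun z ↦ B z a) =ᶠ[𝓝 y]
        fun z ↦ covDerivForm G K' z a (k z) - covDerivForm G K z a (k' z) := by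
      filter_upwards [hG.isOpen.mem_nhds hy] with z hz using hBL z hz a
    have hconn := hKk.connBilin_eq_zero hG hy a (k' y) c
    have hconn' := hKk'.connBilin_eq_zero hG hy a (k y) c
    -- the covariant derivatives of the vector fields are `L` and `L'` with an index raised
    have hn := hG.covDerivForm_eq_metric hk hK hy
    have hn' := hG.covDerivForm_eq_metric hk' hK' hy
    have e := hn ((G y).inverse (covDerivForm G K' y a)) c
    have e' := hn' ((G y).inverse (covDerivForm G K y a)) c
    have hself : ∀ f, G y ((G y).inverse f) = f := (hG.isInvertible y hy).self_apply_inverse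
    rw [hG.symm y hy, hself, map_add] at e e'
    -- these four combine to `R_{akck'} - R_{ak'ck} = R_{ackk'}`
    have hR1 := hG.curvatureLower_bianchi hy a (k y) c (k' y)
    have hR2 := hG.curvatureLower_pair_symm hy (k y) c a (k' y)
    have hR3 := hG.curvatureLower_swap_right hy a (k' y) (k y) c
    have hR4 := curvatureLower_swap_left G y c a (k y) (k' y)
    rw [connBilin, covDerivBilin, hK y hy, hG.symm y hy, ← curvatureLower_apply] at hconn
    rw [connBilin, covDerivBilin, hK' y hy, hG.symm y hy, ← curvatureLower_apply] at hconn'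
    have hfd : fderiv ℝ B y c a = fderiv ℝ (covDerivForm G K') y c a (k y)
        + covDerivForm G K' y a (fderiv ℝ k y c) - (fderiv ℝ (covDerivForm G K) y c a (k' y)
        + covDerivForm G K y a (fderiv ℝ k' y c)) := by
      rw [← fderiv_apply_const (differentiableAt_of_contDiffOn hG.isOpen hBs hy), h.fderiv_eq,
        fderiv_fun_sub (hLa'.clm_apply hkd) (hLa.clm_apply hkd'), sub_apply,
        fderiv_clm_apply_apply hLa' hkd, fderiv_clm_apply_apply hLa hkd',
        fderiv_apply_const hL, fderiv_apply_const hL']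
    rw [covDerivForm_apply, hfd, hBL y hy, e, e', hK y hy, hK' y hy, hinv, hinv]
    linarith

end IsMetricOn

end CoordinateKilling

/-! ### Uniqueness of parallel sections in coordinates -/

section Uniqueness

variable {E : Type*} [NormedAddCommGroup E] [NormedSpace ℝ E]

/-- A function on a ball whose derivative is bounded by a multiple of its norm vanishes if it
vanishes at the centre. -/
theorem eq_zero_of_norm_fderiv_le {P : Type*} [NormedAddCommGroup P] [NormedSpace ℝ P]
    {F : E → P} {y : E} {r C : ℝ} (hF : DifferentiableOn ℝ F (Metric.ball y r)) (hy : F y = 0)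
    (hC : ∀ z ∈ Metric.ball y r, ‖fderiv ℝ F z‖ ≤ C * ‖F z‖) :
    ∀ z ∈ Metric.ball y r, F z = 0 := by
  intro z hz
  -- restrict to the segment from the centre to `z` and apply Grönwall on `[0, 1]`
  have hseg : ∀ t ∈ Icc (0 : ℝ) 1, y + t • (z - y) ∈ Metric.ball y r := by
    intro t ht
    rw [Metric.mem_ball, dist_eq_norm, add_sub_cancel_left, norm_smul, Real.norm_of_nonneg ht.1]
    rw [Metric.mem_ball, dist_eq_norm] at hz
    exact (mul_le_of_le_one_left (norm_nonneg _) ht.2).trans_lt hz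
  have hline : ∀ t ∈ Icc (0 : ℝ) 1, HasDerivAt (fun t : ℝ ↦ F (y + t • (z - y)))
      (fderiv ℝ F (y + t • (z - y)) (z - y)) t := by
    intro t ht
    have hd := (hF.differentiableAt (Metric.isOpen_ball.mem_nhds (hseg t ht))).hasFDerivAt
    have h2 : HasDerivAt (fun t : ℝ ↦ y + t • (z - y)) (z - y) t := by
      simpa using ((hasDerivAt_id t).smul_const (z - y)).const_add y
    exact hd.comp_hasDerivAt t h2
  have := eq_zero_of_abs_deriv_le_mul_abs_self_of_eq_zero_right
    (f := fun t : ℝ ↦ F (y + t • (z - y))) (K := C * ‖z - y‖)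
    (fun t ht ↦ (hline t ht).continuousAt.continuousWithinAt)
    (fun t ht ↦ (hline t (Ico_subset_Icc_self ht)).hasDerivWithinAt) (by simpa using hy)
    (fun t ht ↦ by
      refine (ContinuousLinearMap.le_opNorm _ _).trans ?_
      have := hC _ (hseg t (Ico_subset_Icc_self ht))
      nlinarith [norm_nonneg (z - y)]) 1 (by simp)
  simpa using this

variable [FiniteDimensional ℝ E] {G : E → E →L[ℝ] E →L[ℝ] ℝ} {s : Set E} {y : E}

/-- A parallel section that vanishes at a point vanishes near this point. -/
theorem IsMetricOn.eventually_eq_zero_of_parallel (hG : IsMetricOn G s) {K : E → E →L[ℝ] ℝ}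
    {L : E → E →L[ℝ] E →L[ℝ] ℝ} (hK : ContDiffOn ℝ ∞ K s) (hL : ContDiffOn ℝ ∞ L s)
    (hform : ∀ z ∈ s, ∀ a i, connForm G K L z a i = 0)
    (hbilin : ∀ z ∈ s, ∀ a b i, connBilin G K L z a b i = 0) (hy : y ∈ s) (hKy : K y = 0)
    (hLy : L y = 0) : ∀ᶠ z in 𝓝 y, K z = 0 ∧ L z = 0 := by
  have hsy := hG.isOpen.mem_nhds hy
  have hΓ := (hG.contDiffOn_christoffel.contDiffAt hsy).continuousAt
  have hR := (hG.contDiffOn_curvature.contDiffAt hsy).continuousAt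
  obtain ⟨r, hr, hball⟩ := Metric.mem_nhds_iff.1 (Filter.inter_mem hsy (Filter.inter_mem
    (hΓ.norm.eventually_lt continuousAt_const (lt_add_one ‖christoffel G y‖))
    (hR.norm.eventually_lt continuousAt_const (lt_add_one ‖curvature G y‖))))
  set A := ‖christoffel G y‖ + 1
  set C := ‖curvature G y‖ + 1
  have hA : 0 ≤ A := by positivity
  have hC : 0 ≤ C := by positivity
  have hKd : ∀ z ∈ Metric.ball y r, DifferentiableAt ℝ K z := fun z hz ↦
    differentiableAt_of_contDiffOn hG.isOpen hK (hball hz).1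
  have hLd : ∀ z ∈ Metric.ball y r, DifferentiableAt ℝ L z := fun z hz ↦
    differentiableAt_of_contDiffOn hG.isOpen hL (hball hz).1
  have key := eq_zero_of_norm_fderiv_le (F := fun z ↦ (K z, L z)) (y := y) (r := r)
    (C := 1 + A + (C + 2 * A))
    (fun z hz ↦ ((hKd z hz).prodMk (hLd z hz)).differentiableWithinAt) (by simp [hKy, hLy]) ?_
  · filter_upwards [Metric.ball_mem_nhds y hr] with z hz
    simpa using key z hz
  intro z hz
  have hz' := hball hz
  have hzA : ‖christoffel G z‖ ≤ A := le_of_lt hz'.2.1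
  have hzC : ‖curvature G z‖ ≤ C := le_of_lt hz'.2.2
  rw [(hKd z hz).fderiv_prodMk (hLd z hz)]
  set N := ‖(K z, L z)‖
  have hKN : ‖K z‖ ≤ N := norm_fst_le (K z, L z)
  have hLN : ‖L z‖ ≤ N := norm_snd_le (K z, L z)
  have hN : 0 ≤ N := norm_nonneg _
  have hΓz : ∀ u v, ‖christoffel G z u v‖ ≤ A * ‖u‖ * ‖v‖ := fun u v ↦
    (ContinuousLinearMap.le_opNorm₂ _ u v).trans (by gcongr)
  have hRz : ∀ u v w, ‖curvature G z u v w‖ ≤ C * ‖u‖ * ‖v‖ * ‖w‖ := fun u v w ↦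
    (ContinuousLinearMap.le_opNorm₂ _ v w).trans (by
      gcongr
      exact (ContinuousLinearMap.le_opNorm _ u).trans (by gcongr))
  have hKz : ∀ u, ‖K z u‖ ≤ N * ‖u‖ := fun u ↦ (ContinuousLinearMap.le_opNorm _ u).trans (by gcongr)
  have hLz : ∀ u v, ‖L z u v‖ ≤ N * ‖u‖ * ‖v‖ := fun u v ↦
    (ContinuousLinearMap.le_opNorm₂ _ u v).trans (by gcongr)
  have h1 : ‖fderiv ℝ K z‖ ≤ (1 + A) * N := by
    refine ContinuousLinearMap.opNorm_le_bound₂ _ (by positivity) fun i a ↦ ?_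
    have h := hform z hz'.1 a i
    rw [connForm, covDerivForm_apply] at h
    have e : fderiv ℝ K z i a = L z a i + K z (christoffel G z i a) := by linarith
    rw [e]
    refine (norm_add_le _ _).trans ((add_le_add (hLz a i) ((hKz _).trans
      (mul_le_mul_of_nonneg_left (hΓz i a) hN))).trans_eq ?_)
    ring
  have h2 : ‖fderiv ℝ L z‖ ≤ (C + 2 * A) * N := by
    refine ContinuousLinearMap.opNorm_le_bound _ (by positivity) fun i ↦
      ContinuousLinearMap.opNorm_le_bound₂ _ (by positivity) fun a b ↦ ?_
    have h := hbilin z hz'.1 a b i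
    rw [connBilin, covDerivBilin] at h
    have e : fderiv ℝ L z i a b = K z (curvature G z a b i) + L z (christoffel G z i a) b
      + L z a (christoffel G z i b) := by linarith
    rw [e]
    have e1 := (hKz _).trans (mul_le_mul_of_nonneg_left (hRz a b i) hN)
    have e2 := (hLz (christoffel G z i a) b).trans (mul_le_mul_of_nonneg_right
      (mul_le_mul_of_nonneg_left (hΓz i a) hN) (norm_nonneg b))
    have e3 := (hLz a (christoffel G z i b)).trans (mul_le_mul_of_nonneg_left
      (hΓz i b) (mul_nonneg hN (norm_nonneg a)))
    refine (norm_add₃_le.trans (add_le_add (add_le_add e1 e2) e3)).trans_eq ?_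
    ring
  refine ContinuousLinearMap.opNorm_le_bound _ (by positivity) fun i ↦ ?_
  rw [ContinuousLinearMap.prod_apply, Prod.norm_mk]
  have b1 := (ContinuousLinearMap.le_opNorm (fderiv ℝ K z) i).trans
    (mul_le_mul_of_nonneg_right h1 (norm_nonneg i))
  have b2 := (ContinuousLinearMap.le_opNorm (fderiv ℝ L z) i).trans
    (mul_le_mul_of_nonneg_right h2 (norm_nonneg i))
  have p1 : 0 ≤ (1 + A) * N * ‖i‖ := by positivity
  have p2 : 0 ≤ (C + 2 * A) * N * ‖i‖ := by positivity
  exact max_le (by linarith) (by linarith)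

end Uniqueness

/-! ### Charts and smoothness of sections -/

section Charts

variable {E : Type*} [NormedAddCommGroup E] [NormedSpace ℝ E]
  {M : Type*} [TopologicalSpace M] [ChartedSpace E M]

/-- Evaluation of the components when the base point `e.symm y` is only propositionally equal to
`p`; the fibres are all identified with `E`. -/
theorem formInChart_apply_of_eq {e : OpenPartialHomeomorph M E} (K : ∀ p : M, Cotangent E p)
    {y : E} {p : M} (h : e.symm y = p) (u : E) :
    formInChart e K y u = (K p : E →L[ℝ] ℝ) ((chartSymmDeriv e y : E →L[ℝ] E) u) := by
  subst h; rfl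

/-- The analogue of `formInChart_apply_of_eq` for 2-tensors. -/
theorem bilinInChart_apply_of_eq {e : OpenPartialHomeomorph M E} (L : ∀ p : M, Bilin E p)
    {y : E} {p : M} (h : e.symm y = p) (u v : E) :
    bilinInChart e L y u v = (L p : E →L[ℝ] E →L[ℝ] ℝ) ((chartSymmDeriv e y : E →L[ℝ] E) u)
      ((chartSymmDeriv e y : E →L[ℝ] E) v) := by
  subst h; rfl

variable [IsManifold 𝓘(ℝ, E) ∞ M]

theorem isManifold_one (E M : Type*) [NormedAddCommGroup E] [NormedSpace ℝ E] [TopologicalSpace M]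
    [ChartedSpace E M] [IsManifold 𝓘(ℝ, E) ∞ M] : IsManifold 𝓘(ℝ, E) 1 M :=
  .of_le (n := ∞) (by simp)

variable {e : OpenPartialHomeomorph M E} (he : e ∈ IsManifold.maximalAtlas 𝓘(ℝ, E) ∞ M)

include he

theorem mdifferentiable_of_mem_maximalAtlas : e.MDifferentiable 𝓘(ℝ, E) 𝓘(ℝ, E) :=
  ⟨(contMDiffOn_of_mem_maximalAtlas he).mdifferentiableOn (by simp),
    (contMDiffOn_symm_of_mem_maximalAtlas he).mdifferentiableOn (by simp)⟩

theorem chartDeriv_chartSymmDeriv {y : E} (hy : y ∈ e.target) (u : E) :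
    chartDeriv e (e.symm y) (chartSymmDeriv e y u) = u :=
  congrArg (fun f : E →L[ℝ] E ↦ f u)
    ((mdifferentiable_of_mem_maximalAtlas he).comp_symm_deriv hy)

theorem chartSymmDeriv_chartDeriv {p : M} (hp : p ∈ e.source) (v : TangentSpace 𝓘(ℝ, E) p) :
    (chartSymmDeriv e (e p) : E →L[ℝ] E) (chartDeriv e p v) = v :=
  congrArg (fun f : TangentSpace 𝓘(ℝ, E) p →L[ℝ] TangentSpace 𝓘(ℝ, E) p ↦ f v)
    ((mdifferentiable_of_mem_maximalAtlas he).symm_comp_deriv hp)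

theorem chartSymmDeriv_chartDeriv' {y : E} (hy : y ∈ e.target)
    (v : TangentSpace 𝓘(ℝ, E) (e.symm y)) :
    chartSymmDeriv e y (chartDeriv e (e.symm y) v) = v := by
  have h := chartSymmDeriv_chartDeriv he (e.map_target hy) v
  rwa [e.right_inv hy] at h

theorem chartSymmDeriv_isInvertible {y : E} (hy : y ∈ e.target) :
    (chartSymmDeriv e y).IsInvertible :=
  ⟨ContinuousLinearEquiv.equivOfInverse (chartSymmDeriv e y) (chartDeriv e (e.symm y))
    (chartDeriv_chartSymmDeriv he hy) (chartSymmDeriv_chartDeriv' he hy), rfl⟩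

omit he

section Smooth

theorem chartSymmDeriv_eq_symmL {p q : M} (hq : q ∈ (chartAt E p).source) :
    (trivializationAt E (TangentSpace 𝓘(ℝ, E)) p).symmL ℝ q =
      (chartSymmDeriv (chartAt E p) (chartAt E p q) : E →L[ℝ] E) := by
  have := isManifold_one E M
  rw [TangentBundle.symmL_trivializationAt hq]
  simp only [chartSymmDeriv, modelWithCornersSelf_coe, range_id, mfderivWithin_univ]
  rfl

/-- A one-form is smooth at `p` if its components in the preferred chart at `p` are. -/
theorem contMDiffAt_form {K : ∀ p : M, Cotangent E p} {p : M}
    (hK : ContDiffAt ℝ ∞ (formInChart (chartAt E p) K) (chartAt E p p)) :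
    ContMDiffAt 𝓘(ℝ, E) (𝓘(ℝ, E).prod 𝓘(ℝ, E →L[ℝ] ℝ)) ∞
      (fun p ↦ Bundle.TotalSpace.mk' (E →L[ℝ] ℝ) p (K p)) p := by
  have := isManifold_one E M
  refine (contMDiffAt_hom_bundle (E₂ := Bundle.Trivial M ℝ) _).2 ⟨contMDiffAt_id, ?_⟩
  have hc := hK.contMDiffAt.comp p (contMDiffAt_of_mem_maximalAtlas
    (IsManifold.chart_mem_maximalAtlas (I := 𝓘(ℝ, E)) (n := ∞) p) (mem_chart_source E p))
  refine hc.congr_of_eventuallyEq ?_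
  filter_upwards [(chartAt E p).open_source.mem_nhds (mem_chart_source E p)] with q hq
  ext u
  rw [Function.comp_apply, formInChart_apply_of_eq K ((chartAt E p).left_inv hq)]
  simp only [ContinuousLinearMap.inCoordinates, ContinuousLinearMap.comp_apply]
  rw [chartSymmDeriv_eq_symmL hq]
  simp
  rfl

/-- A covariant 2-tensor is smooth at `p` if its components in the preferred chart at `p` are. -/
theorem contMDiffAt_bilin {L : ∀ p : M, Bilin E p} {p : M}
    (hL : ContDiffAt ℝ ∞ (bilinInChart (chartAt E p) L) (chartAt E p p)) :
    ContMDiffAt 𝓘(ℝ, E) (𝓘(ℝ, E).prod 𝓘(ℝ, E →L[ℝ] E →L[ℝ] ℝ)) ∞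
      (fun p ↦ Bundle.TotalSpace.mk' (E →L[ℝ] E →L[ℝ] ℝ) p (L p)) p := by
  have := isManifold_one E M
  refine (contMDiffAt_hom_bundle (E₂ := fun p : M ↦ Cotangent E p) _).2 ⟨contMDiffAt_id, ?_⟩
  have hc := hL.contMDiffAt.comp p (contMDiffAt_of_mem_maximalAtlas
    (IsManifold.chart_mem_maximalAtlas (I := 𝓘(ℝ, E)) (n := ∞) p) (mem_chart_source E p))
  refine hc.congr_of_eventuallyEq ?_
  filter_upwards [(chartAt E p).open_source.mem_nhds (mem_chart_source E p)] with q hq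
  ext u v
  rw [Function.comp_apply, bilinInChart_apply_of_eq L ((chartAt E p).left_inv hq)]
  have hb : q ∈ (trivializationAt E (TangentSpace 𝓘(ℝ, E) : M → Type _) p).baseSet := by
    simpa using hq
  have h := inCoordinates_apply_eq₂ (𝕜 := ℝ) (F₁ := E) (F₂ := E) (F₃ := ℝ)
    (E₁ := (TangentSpace 𝓘(ℝ, E) : M → Type _)) (E₂ := (TangentSpace 𝓘(ℝ, E) : M → Type _))
    (E₃ := Bundle.Trivial M ℝ) (x₀ := p) (x := q) (ϕ := L q) (v := u) (w := v) hb hb (by simp)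
  refine h.trans ?_
  rw [← Bundle.Trivialization.symmL_apply (R := ℝ) _ hb,
    ← Bundle.Trivialization.symmL_apply (R := ℝ) _ hb, chartSymmDeriv_eq_symmL hq]
  simp
  rfl

end Smooth

end Charts

/-! ### Metric, brackets and covariant derivatives in charts -/

section MetricInCharts

variable {E : Type*} [NormedAddCommGroup E] [NormedSpace ℝ E] [FiniteDimensional ℝ E]
  {M : Type*} [TopologicalSpace M] [ChartedSpace E M] [IsManifold 𝓘(ℝ, E) ∞ M]
  (g : PseudoRiemannianMetric E M) {U : Opens M} {e : OpenPartialHomeomorph M E}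

theorem PseudoRiemannianMetric.isInvertible (p : M) : (g.val p).IsInvertible :=
  isInvertible_of_nondegenerate (E := E) (h := g.val p) (g.nondegenerate p)

theorem PseudoRiemannianMetric.isMetricOn (he : e ∈ IsManifold.maximalAtlas 𝓘(ℝ, E) ∞ M) :
    IsMetricOn (bilinInChart e g.val) e.target where
  isOpen := e.open_target
  contDiffOn := by simpa using g.smooth.contDiffOn isOpen_univ he
  symm _ _ _ _ := g.symm _ _ _
  isInvertible z hz := isInvertible_of_nondegenerate fun v hv ↦ by
    apply (chartSymmDeriv_isInvertible he hz).injective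
    rw [map_zero]
    refine g.nondegenerate _ _ fun w ↦ ?_
    rw [← chartSymmDeriv_chartDeriv' he hz w]
    exact hv _

theorem PseudoRiemannianMetric.isMetricOn_inter
    (he : e ∈ IsManifold.maximalAtlas 𝓘(ℝ, E) ∞ M) (U : Opens M) :
    IsMetricOn (bilinInChart e g.val) (e.target ∩ e.symm ⁻¹' U) :=
  (g.isMetricOn he).mono (isOpen_chartDomain e U.isOpen) inter_subset_left

theorem isKillingOn_of_mem_killing {K : ∀ p : M, Cotangent E p} (hK : K ∈ killing g U)
    (he : e ∈ IsManifold.maximalAtlas 𝓘(ℝ, E) ∞ M) :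
    IsKillingOn (bilinInChart e g.val) (formInChart e K) (e.target ∩ e.symm ⁻¹' U) where
  contDiffOn := hK.1.contDiffOn U.isOpen he
  killing z hz := hK.2.2 e he z hz.1 hz.2

/-- The components in the chart `e` of the vector field `K^a`. -/
noncomputable def sharpInChart (e : OpenPartialHomeomorph M E)
    (K : ∀ p : M, Cotangent E p) (y : E) : E :=
  (bilinInChart e g.val y).inverse (formInChart e K y)

theorem formInChart_eq_metric (he : e ∈ IsManifold.maximalAtlas 𝓘(ℝ, E) ∞ M)
    (K : ∀ p : M, Cotangent E p) {y : E} (hy : y ∈ e.target) :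
    formInChart e K y = bilinInChart e g.val y (sharpInChart g e K y) :=
  (((g.isMetricOn he).isInvertible y hy).self_apply_inverse _).symm

theorem metric_sharp (K : ∀ p : M, Cotangent E p) (p : M) : g.val p (sharp g K p) = K p :=
  (g.isInvertible p).self_apply_inverse _

/-- Raising the index commutes with passing to components in a chart. -/
theorem sharp_eq_chartSymmDeriv (he : e ∈ IsManifold.maximalAtlas 𝓘(ℝ, E) ∞ M)
    (K : ∀ p : M, Cotangent E p) {y : E} (hy : y ∈ e.target) :
    sharp g K (e.symm y) = chartSymmDeriv e y (sharpInChart g e K y) := by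
  refine (g.isInvertible (e.symm y)).injective ?_
  rw [metric_sharp]
  refine ContinuousLinearMap.ext fun w ↦ ?_
  have h := congrArg (fun f : E →L[ℝ] ℝ ↦ f (chartDeriv e (e.symm y) w))
    (formInChart_eq_metric g he K hy)
  rw [← chartSymmDeriv_chartDeriv' he hy w]
  exact h

theorem contDiffOn_sharpInChart (he : e ∈ IsManifold.maximalAtlas 𝓘(ℝ, E) ∞ M)
    {K : ∀ p : M, Cotangent E p} (hK : SmoothFormOn K U) :
    ContDiffOn ℝ ∞ (sharpInChart g e K) (e.target ∩ e.symm ⁻¹' U) :=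
  (g.isMetricOn_inter he U).contDiffOn_sharp (hK.contDiffOn U.isOpen he)

theorem contMDiffAt_sharp {K : ∀ p : M, Cotangent E p} (hK : SmoothFormOn K U) {p : M}
    (hp : p ∈ U) :
    ContMDiffAt 𝓘(ℝ, E) (𝓘(ℝ, E).prod 𝓘(ℝ, E)) ∞
      (fun q ↦ Bundle.TotalSpace.mk' E (E := (TangentSpace 𝓘(ℝ, E) : M → Type _)) q (sharp g K q))
      p := by
  have := isManifold_one E M
  set e := chartAt E p
  have he : e ∈ IsManifold.maximalAtlas 𝓘(ℝ, E) ∞ M := IsManifold.chart_mem_maximalAtlas p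
  have hpe : p ∈ e.source := mem_chart_source E p
  have hy : e p ∈ e.target := e.map_source hpe
  have hk : ContDiffAt ℝ ∞ (sharpInChart g e K) (e p) :=
    (contDiffOn_sharpInChart g he hK).contDiffAt ((isOpen_chartDomain e U.isOpen).mem_nhds
      ⟨hy, by simpa [e.left_inv hpe] using hp⟩)
  set k : E → E := sharpInChart g e K with hkdef
  -- the section is the image under the tangent map of `e.symm` of a smooth vector field on `E`
  have h1 := (contMDiffOn_symm_of_mem_maximalAtlas he).contMDiffOn_tangentMapWithin
    (m := ∞) (by simp) e.open_target.uniqueMDiffOn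
  have h2 : ContMDiffAt 𝓘(ℝ, E) (𝓘(ℝ, E).prod 𝓘(ℝ, E)) ∞
      (fun z : E ↦ (⟨z, (show E from k z)⟩ : TangentBundle 𝓘(ℝ, E) E)) (e p) :=
    contMDiffAt_vectorSpace_iff_contDiffAt (V := k) |>.2 hk
  have h3 := ((h1 ⟨e p, (show E from k (e p))⟩ hy).comp_of_eq (s := e.target)
    h2.contMDiffWithinAt (fun z hz ↦ hz) rfl).contMDiffAt (e.open_target.mem_nhds hy)
  refine (h3.comp p (contMDiffAt_of_mem_maximalAtlas he hpe)).congr_of_eventuallyEq ?_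
  filter_upwards [e.open_source.mem_nhds hpe] with q hq
  simp only [Function.comp_apply, tangentMapWithin,
    mfderivWithin_of_isOpen e.open_target (e.map_source hq)]
  have hs := sharp_eq_chartSymmDeriv g he K (e.map_source hq)
  rw [e.left_inv hq] at hs ⊢
  rw [hs]
  rfl

theorem sharpInChart_eq_mpullback (he : e ∈ IsManifold.maximalAtlas 𝓘(ℝ, E) ∞ M)
    (K : ∀ p : M, Cotangent E p) {y : E} (hy : y ∈ e.target) :
    VectorField.mpullback 𝓘(ℝ, E) 𝓘(ℝ, E) e.symm (sharp g K) y = sharpInChart g e K y := by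
  rw [VectorField.mpullback_apply, sharp_eq_chartSymmDeriv g he K hy]
  exact (chartSymmDeriv_isInvertible he hy).inverse_apply_self _

/-- In a chart, the bracket of one-forms is computed by the Lie bracket of their components. -/
theorem formInChart_fieldBracket (he : e ∈ IsManifold.maximalAtlas 𝓘(ℝ, E) ∞ M)
    {K K' : ∀ p : M, Cotangent E p} (hK : SmoothFormOn K U) (hK' : SmoothFormOn K' U) {y : E}
    (hy : y ∈ e.target) (hyU : e.symm y ∈ U) :
    formInChart e (fieldBracket g U K K') y = bilinInChart e g.val y
      (VectorField.lieBracket ℝ (sharpInChart g e K) (sharpInChart g e K') y) := by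
  have : IsManifold 𝓘(ℝ, E) (minSmoothness ℝ 2) M :=
    .of_le (n := ∞) (by simp; exact ENat.LEInfty.out)
  have : CompleteSpace E := FiniteDimensional.complete ℝ E
  have hpull := VectorField.mpullback_mlieBracket (x₀ := y) (n := ∞) (f := e.symm)
    (I := 𝓘(ℝ, E)) (I' := 𝓘(ℝ, E))
    ((contMDiffAt_sharp g hK hyU).mdifferentiableAt (by simp))
    ((contMDiffAt_sharp g hK' hyU).mdifferentiableAt (by simp))
    (contMDiffAt_symm_of_mem_maximalAtlas he hy) (by simp; exact ENat.LEInfty.out)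
  have hev : ∀ K : ∀ p : M, Cotangent E p,
      VectorField.mpullback 𝓘(ℝ, E) 𝓘(ℝ, E) e.symm (sharp g K) =ᶠ[𝓝 y] sharpInChart g e K := by
    intro K
    filter_upwards [e.open_target.mem_nhds hy] with z hz using sharpInChart_eq_mpullback g he K hz
  have hflat : ∀ V W : ∀ z : E, TangentSpace 𝓘(ℝ, E) z,
      VectorField.mlieBracket 𝓘(ℝ, E) V W y = VectorField.lieBracket ℝ V W y := by
    intro V W
    rw [← VectorField.mlieBracketWithin_univ, VectorField.mlieBracketWithin_eq_lieBracketWithin]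
    exact congrFun (VectorField.lieBracketWithin_univ (V := (V : E → E)) (W := (W : E → E))) y
  rw [(hev K).mlieBracket_vectorField_eq (hev K'), VectorField.mpullback_apply] at hpull
  have hpull' := hpull.trans (hflat _ _)
  ext u
  have hbr : fieldBracket g U K K' (e.symm y) = g.val (e.symm y)
      (VectorField.mlieBracket 𝓘(ℝ, E) (sharp g K) (sharp g K') (e.symm y)) := if_pos hyU
  rw [← hpull']
  change fieldBracket g U K K' (e.symm y) (chartSymmDeriv e y u) = g.val (e.symm y)
    (chartSymmDeriv e y ((chartSymmDeriv e y).inverse _)) (chartSymmDeriv e y u)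
  rw [hbr, (chartSymmDeriv_isInvertible he hy).self_apply_inverse]

section Transition

variable {e' : OpenPartialHomeomorph M E}

/-- The change of basis between two charts is the derivative of the transition map. -/
theorem chartSymmDeriv_eq_comp_fderiv (he : e ∈ IsManifold.maximalAtlas 𝓘(ℝ, E) ∞ M)
    (he' : e' ∈ IsManifold.maximalAtlas 𝓘(ℝ, E) ∞ M) {y : E} (hy : y ∈ e.target)
    (hy' : e.symm y ∈ e'.source) (u : E) :
    chartDeriv e' (e.symm y) (chartSymmDeriv e y u) = fderiv ℝ (e' ∘ e.symm) y u := by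
  have h := mfderiv_comp (I := 𝓘(ℝ, E)) (I' := 𝓘(ℝ, E)) (I'' := 𝓘(ℝ, E)) y
    ((mdifferentiable_of_mem_maximalAtlas he').mdifferentiableAt hy')
    ((mdifferentiable_of_mem_maximalAtlas he).mdifferentiableAt_symm hy)
  rw [mfderiv_eq_fderiv] at h
  exact (congrArg (fun f : E →L[ℝ] E ↦ f u) h).symm

theorem contDiffAt_transition (he : e ∈ IsManifold.maximalAtlas 𝓘(ℝ, E) ∞ M)
    (he' : e' ∈ IsManifold.maximalAtlas 𝓘(ℝ, E) ∞ M) {y : E} (hy : y ∈ e.target)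
    (hy' : e.symm y ∈ e'.source) : ContDiffAt ℝ ∞ (e' ∘ e.symm) y :=
  ((contMDiffAt_of_mem_maximalAtlas he' hy').comp y
    (contMDiffAt_symm_of_mem_maximalAtlas he hy)).contDiffAt

theorem formInChart_transition (he : e ∈ IsManifold.maximalAtlas 𝓘(ℝ, E) ∞ M)
    (he' : e' ∈ IsManifold.maximalAtlas 𝓘(ℝ, E) ∞ M) (K : ∀ p : M, Cotangent E p) {y : E}
    (hy : y ∈ e.target) (hy' : e.symm y ∈ e'.source) (u : E) :
    formInChart e K y u =
      formInChart e' K (e' (e.symm y)) (fderiv ℝ (e' ∘ e.symm) y u) := by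
  rw [← chartSymmDeriv_eq_comp_fderiv he he' hy hy',
    formInChart_apply_of_eq K (e'.left_inv hy')]
  have h := chartSymmDeriv_chartDeriv he' hy' (chartSymmDeriv e y u)
  exact congrArg (K (e.symm y)) h.symm

/-- The exterior derivative of a one-form is compatible with changes of charts. -/
theorem fderiv_formInChart_sub (he : e ∈ IsManifold.maximalAtlas 𝓘(ℝ, E) ∞ M)
    (he' : e' ∈ IsManifold.maximalAtlas 𝓘(ℝ, E) ∞ M) {K : ∀ p : M, Cotangent E p}
    (hK : SmoothFormOn K U) {y : E} (hy : y ∈ e.target) (hy' : e.symm y ∈ e'.source)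
    (hyU : e.symm y ∈ U) (a b : E) :
    fderiv ℝ (formInChart e K) y b a - fderiv ℝ (formInChart e K) y a b =
      fderiv ℝ (formInChart e' K) (e' (e.symm y)) (fderiv ℝ (e' ∘ e.symm) y b)
          (fderiv ℝ (e' ∘ e.symm) y a)
        - fderiv ℝ (formInChart e' K) (e' (e.symm y)) (fderiv ℝ (e' ∘ e.symm) y a)
          (fderiv ℝ (e' ∘ e.symm) y b) := by
  -- the second derivatives of the transition map are symmetric and cancel
  set φ := e' ∘ e.symm with hφ
  have hφs := contDiffAt_transition he he' hy hy'
  have hd := hK.differentiableAt U.isOpen he hy hyU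
  have hd' : DifferentiableAt ℝ (formInChart e' K) (φ y) :=
    hK.differentiableAt U.isOpen he' (e'.map_source hy') (by simpa [hφ, e'.left_inv hy'] using hyU)
  have hφd : DifferentiableAt ℝ φ y := hφs.differentiableAt (by simp)
  have hφdd : DifferentiableAt ℝ (fderiv ℝ φ) y :=
    (hφs.fderiv_right (m := ∞) (by simp)).differentiableAt (by simp)
  have hcomp : DifferentiableAt ℝ (fun z ↦ formInChart e' K (φ z)) y := hd'.comp y hφd
  have key : ∀ a b, fderiv ℝ (formInChart e K) y b a =
      fderiv ℝ (formInChart e' K) (φ y) (fderiv ℝ φ y b) (fderiv ℝ φ y a)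
        + formInChart e' K (φ y) (fderiv ℝ (fderiv ℝ φ) y b a) := by
    intro a b
    have hev : (fun z ↦ formInChart e K z a) =ᶠ[𝓝 y]
        fun z ↦ formInChart e' K (φ z) (fderiv ℝ φ z a) := by
      filter_upwards [e.open_target.mem_nhds hy, (e.continuousAt_symm hy).preimage_mem_nhds
        (e'.open_source.mem_nhds hy')] with z hz hz' using formInChart_transition he he' K hz hz' a
    rw [← fderiv_apply_const hd, hev.fderiv_eq,
      fderiv_clm_apply_apply hcomp (hφdd.clm_apply (by simp)), fderiv_apply_const hφdd]
    have : fderiv ℝ (fun z ↦ formInChart e' K (φ z)) y = _ := fderiv_comp y hd' hφd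
    rw [this]
    rfl
  rw [key, key, fderiv_fderiv_comm hφs a b]
  simp only [hφ, Function.comp_apply]
  ring

end Transition

/-- The Christoffel symbols drop out of the skew part of the covariant derivative. -/
theorem IsKillingOn.two_mul_covDerivForm {G : E → E →L[ℝ] E →L[ℝ] ℝ} {K : E → E →L[ℝ] ℝ}
    {s : Set E} (hK : IsKillingOn G K s) (hG : IsMetricOn G s) {y : E} (hy : y ∈ s) (a b : E) :
    2 * covDerivForm G K y a b = fderiv ℝ K y b a - fderiv ℝ K y a b := by
  have h := hK.covDerivForm_skew hy a b
  simp only [covDerivForm_apply] at h ⊢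
  rw [hG.christoffel_symm hy a b] at h
  linarith

/-- The tensor `K_{a;b}` of a Killing field, defined through preferred charts, is given in every
chart by the coordinate formula: being skew, it is half of the exterior derivative. -/
theorem bilinInChart_covDeriv (he : e ∈ IsManifold.maximalAtlas 𝓘(ℝ, E) ∞ M)
    {K : ∀ p : M, Cotangent E p} (hK : K ∈ killing g U) {y : E} (hy : y ∈ e.target)
    (hyU : e.symm y ∈ U) :
    bilinInChart e (covDeriv g K) y =
      covDerivForm (bilinInChart e g.val) (formInChart e K) y := by
  ext a b
  set e' := chartAt E (e.symm y)
  have he' : e' ∈ IsManifold.maximalAtlas 𝓘(ℝ, E) ∞ M := IsManifold.chart_mem_maximalAtlas _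
  have hy' : e.symm y ∈ e'.source := mem_chart_source E _
  change covDerivForm (bilinInChart e' g.val) (formInChart e' K) (e' (e.symm y))
    (chartDeriv e' (e.symm y) (chartSymmDeriv e y a))
    (chartDeriv e' (e.symm y) (chartSymmDeriv e y b)) = _
  rw [chartSymmDeriv_eq_comp_fderiv he he' hy hy', chartSymmDeriv_eq_comp_fderiv he he' hy hy']
  have h := (isKillingOn_of_mem_killing g hK he).two_mul_covDerivForm (g.isMetricOn_inter he U)
    (y := y) ⟨hy, hyU⟩ a b
  have h' := (isKillingOn_of_mem_killing g hK he').two_mul_covDerivForm (g.isMetricOn_inter he' U)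
    (y := e' (e.symm y)) ⟨e'.map_source hy', by simpa [e'.left_inv hy'] using hyU⟩
    (fderiv ℝ (e' ∘ e.symm) y a) (fderiv ℝ (e' ∘ e.symm) y b)
  have ht := fderiv_formInChart_sub he he' hK.1 hy hy' hyU a b
  linarith

end MetricInCharts

/-! ### Killing fields and parallel sections -/

section TensorBracketPullback

variable {V W : Type*} [AddCommGroup V] [Module ℝ V] [TopologicalSpace V]
  [IsTopologicalAddGroup V] [ContinuousSMul ℝ V]
  [AddCommGroup W] [Module ℝ W] [TopologicalSpace W]
  [IsTopologicalAddGroup W] [ContinuousSMul ℝ W]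

/-- The algebraic bracket is natural under linear isomorphisms. -/
theorem tensorBracket_pull {D : V →L[ℝ] W} (hD : Function.Surjective D)
    (B : W →L[ℝ] W →L[ℝ] W →L[ℝ] W →L[ℝ] ℝ) {h : W →L[ℝ] W →L[ℝ] ℝ} (hh : h.IsInvertible)
    (hp : (pullBilin D h).IsInvertible) (X X' : (W →L[ℝ] ℝ) × (W →L[ℝ] W →L[ℝ] ℝ)) :
    tensorBracket (pullQuad D B) (pullBilin D h) (X.1.comp D, pullBilin D X.2)
      (X'.1.comp D, pullBilin D X'.2) =
      ((tensorBracket B h X X').1.comp D, pullBilin D (tensorBracket B h X X').2) := by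
  have hinv : ∀ κ : W →L[ℝ] ℝ, D ((pullBilin D h).inverse (κ.comp D)) = h.inverse κ := by
    intro κ
    obtain ⟨v, hv⟩ := hD (h.inverse κ)
    have : (pullBilin D h).inverse (κ.comp D) = v := by
      rw [hp.inverse_apply_eq]
      ext w
      rw [pullBilin_apply, hv, hh.self_apply_inverse]
      rfl
    rw [this, hv]
  refine Prod.ext ?_ ?_
  · ext a
    change X'.2 (D a) (D ((pullBilin D h).inverse (X.1.comp D)))
      - X.2 (D a) (D ((pullBilin D h).inverse (X'.1.comp D))) = _
    rw [hinv, hinv]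
    rfl
  · ext a c
    change X.2 (D ((pullBilin D h).inverse ((X'.2 (D a)).comp D))) (D c)
      - X'.2 (D ((pullBilin D h).inverse ((X.2 (D a)).comp D))) (D c)
      + B (D a) (D c) (D ((pullBilin D h).inverse (X.1.comp D)))
        (D ((pullBilin D h).inverse (X'.1.comp D))) = _
    rw [hinv, hinv, hinv, hinv]
    rfl

end TensorBracketPullback

section Correspondence

variable {E : Type*} [NormedAddCommGroup E] [NormedSpace ℝ E] [FiniteDimensional ℝ E]
  {M : Type*} [TopologicalSpace M] [ChartedSpace E M] [IsManifold 𝓘(ℝ, E) ∞ M]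
  (g : PseudoRiemannianMetric E M) {U : Opens M}

theorem form_eq_formInChart_comp {e : OpenPartialHomeomorph M E}
    (he : e ∈ IsManifold.maximalAtlas 𝓘(ℝ, E) ∞ M) (K : ∀ p : M, Cotangent E p) {p : M}
    (hp : p ∈ e.source) : K p = (formInChart e K (e p)).comp (chartDeriv e p) := by
  refine ContinuousLinearMap.ext fun v ↦ ?_
  rw [ContinuousLinearMap.comp_apply, formInChart_apply_of_eq K (e.left_inv hp)]
  exact congrArg (K p) (chartSymmDeriv_chartDeriv he hp v).symm

theorem bilin_eq_pullBilin {e : OpenPartialHomeomorph M E}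
    (he : e ∈ IsManifold.maximalAtlas 𝓘(ℝ, E) ∞ M) (L : ∀ p : M, Bilin E p) {p : M}
    (hp : p ∈ e.source) : L p = pullBilin (chartDeriv e p) (bilinInChart e L (e p)) := by
  refine ContinuousLinearMap.ext fun v ↦ ContinuousLinearMap.ext fun w ↦ ?_
  rw [pullBilin_apply, bilinInChart_apply_of_eq L (e.left_inv hp)]
  exact (congrArg₂ (fun v w ↦ L p v w) (chartSymmDeriv_chartDeriv he hp v)
    (chartSymmDeriv_chartDeriv he hp w)).symm

theorem phi_apply {K : ∀ p : M, Cotangent E p} {p : M} (hp : p ∈ U) :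
    phi g U K p = (K p, covDeriv g K p) := if_pos hp

/-- If `K` is a Killing field, then `K_a + K_{a;b}` is a parallel section. -/
theorem phi_mem_parallel {K : ∀ p : M, Cotangent E p} (hK : K ∈ killing g U) :
    phi g U K ∈ parallel g U := by
  have hform : ∀ {e : OpenPartialHomeomorph M E} {z : E}, e.symm z ∈ U →
      formInChart e (fun p ↦ (phi g U K p).1) z = formInChart e K z := by
    intro e z hz
    ext u
    change (phi g U K (e.symm z)).1 _ = _
    rw [phi_apply g hz]
    rfl
  have hbilin : ∀ {e : OpenPartialHomeomorph M E} {z : E},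
      e ∈ IsManifold.maximalAtlas 𝓘(ℝ, E) ∞ M → z ∈ e.target → e.symm z ∈ U →
      bilinInChart e (fun p ↦ (phi g U K p).2) z =
        covDerivForm (bilinInChart e g.val) (formInChart e K) z := by
    intro e z he hz hzU
    rw [← bilinInChart_covDeriv g he hK hz hzU]
    ext u v
    change (phi g U K (e.symm z)).2 _ _ = _
    rw [phi_apply g hzU]
    rfl
  have hnhds : ∀ {e : OpenPartialHomeomorph M E} {z : E}, z ∈ e.target → e.symm z ∈ U →
      ∀ᶠ w in 𝓝 z, w ∈ e.target ∩ e.symm ⁻¹' U := fun {e z} hz hzU ↦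
    (isOpen_chartDomain e U.isOpen).mem_nhds ⟨hz, hzU⟩
  refine ⟨?_, ?_, fun p hp ↦ if_neg hp, ?_, ?_⟩
  · exact hK.1.congr fun p hp ↦ by beta_reduce; rw [phi_apply g hp]
  · intro p hp
    refine (contMDiffAt_bilin ?_).contMDiffWithinAt
    have he := IsManifold.chart_mem_maximalAtlas (I := 𝓘(ℝ, E)) (n := ∞) p
    have hpe := mem_chart_source E p
    have hy := (chartAt E p).map_source hpe
    have hyU : (chartAt E p).symm (chartAt E p p) ∈ U := by
      rw [(chartAt E p).left_inv hpe]; exact hp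
    refine (((g.isMetricOn_inter he U).contDiffOn_covDerivForm
      (hK.1.contDiffOn U.isOpen he)).contDiffAt (hnhds hy hyU)).congr_of_eventuallyEq ?_
    filter_upwards [hnhds hy hyU] with z hz using hbilin he hz.1 hz.2
  · intro p hp v w
    rw [phi_apply g hp]
    have he := IsManifold.chart_mem_maximalAtlas (I := 𝓘(ℝ, E)) (n := ∞) p
    have hpe := mem_chart_source E p
    refine (isKillingOn_of_mem_killing g hK he).covDerivForm_skew
      ⟨(chartAt E p).map_source hpe, ?_⟩ _ _
    rw [mem_preimage, (chartAt E p).left_inv hpe]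
    exact hp
  · intro e he y hy hyU
    have hf : formInChart e (fun p ↦ (phi g U K p).1) =ᶠ[𝓝 y] formInChart e K := by
      filter_upwards [hnhds hy hyU] with z hz using hform hz.2
    have hb : bilinInChart e (fun p ↦ (phi g U K p).2) =ᶠ[𝓝 y]
        covDerivForm (bilinInChart e g.val) (formInChart e K) := by
      filter_upwards [hnhds hy hyU] with z hz using hbilin he hz.1 hz.2
    refine ⟨fun a i ↦ ?_, fun a b i ↦ ?_⟩
    · rw [connForm, covDerivForm_apply, hf.fderiv_eq, hf.eq_of_nhds, hb.eq_of_nhds,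
        covDerivForm_apply, sub_self]
    · have h := (isKillingOn_of_mem_killing g hK he).connBilin_eq_zero (g.isMetricOn_inter he U)
        (y := y) ⟨hy, hyU⟩ a b i
      rw [connBilin, covDerivBilin] at h ⊢
      rw [hb.fderiv_eq, hf.eq_of_nhds, hb.eq_of_nhds]
      exact h

/-- Every parallel section comes from a Killing field, namely from its one-form component. -/
theorem exists_killing_of_mem_parallel {X : ∀ p : M, Cotangent E p × Bilin E p}
    (hX : X ∈ parallel g U) : (fun p ↦ (X p).1) ∈ killing g U ∧ phi g U (fun p ↦ (X p).1) = X := by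
  obtain ⟨hs1, hs2, h0, hskew, hpar⟩ := hX
  refine ⟨⟨hs1, fun p hp ↦ congrArg Prod.fst (h0 p hp), fun e he y hy hyU a b ↦ ?_⟩, ?_⟩
  · have h1 := (hpar e he y hy hyU).1 a b
    have h2 := (hpar e he y hy hyU).1 b a
    rw [connForm] at h1 h2
    have h3 : bilinInChart e (fun p ↦ (X p).2) y a b = -bilinInChart e (fun p ↦ (X p).2) y b a :=
      hskew _ hyU _ _
    linarith
  · funext p
    by_cases hp : p ∈ U
    · rw [phi_apply g hp]
      refine Prod.ext rfl ?_
      have he := IsManifold.chart_mem_maximalAtlas (I := 𝓘(ℝ, E)) (n := ∞) p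
      have hpe := mem_chart_source E p
      change covDeriv g _ p = (X p).2
      rw [bilin_eq_pullBilin he (fun p ↦ (X p).2) hpe]
      change pullBilin _ _ = _
      congr 1
      ext a b
      refine sub_eq_zero.1 ((hpar _ he _ ((chartAt E p).map_source hpe) ?_).1 a b)
      rw [(chartAt E p).left_inv hpe]
      exact hp
    · rw [h0 p hp]
      exact if_neg hp

/-- In every chart, the bracket of two Killing fields is smooth, and together with its covariant
derivative it is given by the algebraic bracket. -/
theorem inChart_fieldBracket {K K' : ∀ p : M, Cotangent E p} (hK : K ∈ killing g U)
    (hK' : K' ∈ killing g U) {e : OpenPartialHomeomorph M E}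
    (he : e ∈ IsManifold.maximalAtlas 𝓘(ℝ, E) ∞ M) :
    ContDiffOn ℝ ∞ (formInChart e (fieldBracket g U K K')) (e.target ∩ e.symm ⁻¹' U) ∧
    ∀ y ∈ e.target ∩ e.symm ⁻¹' U, (formInChart e (fieldBracket g U K K') y,
      covDerivForm (bilinInChart e g.val) (formInChart e (fieldBracket g U K K')) y) =
      tensorBracket (curvatureLower (bilinInChart e g.val) y) (bilinInChart e g.val y)
        (formInChart e K y, covDerivForm (bilinInChart e g.val) (formInChart e K) y)
        (formInChart e K' y, covDerivForm (bilinInChart e g.val) (formInChart e K') y) := by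
  have hG := g.isMetricOn_inter he U
  have hk := contDiffOn_sharpInChart g he hK.1
  have hk' := contDiffOn_sharpInChart g he hK'.1
  have hB : ∀ z ∈ e.target ∩ e.symm ⁻¹' U, formInChart e (fieldBracket g U K K') z =
      bilinInChart e g.val z
        (VectorField.lieBracket ℝ (sharpInChart g e K) (sharpInChart g e K') z) :=
    fun z hz ↦ formInChart_fieldBracket g he hK.1 hK'.1 hz.1 hz.2
  have hs : ContDiffOn ℝ ∞ (formInChart e (fieldBracket g U K K')) (e.target ∩ e.symm ⁻¹' U) := by
    refine (hG.contDiffOn.clm_apply ?_).congr hB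
    exact ((contDiffOn_fderiv hG.isOpen hk').clm_apply hk).sub
      ((contDiffOn_fderiv hG.isOpen hk).clm_apply hk')
  exact ⟨hs, fun y hy ↦ hG.covDerivForm_lieBracket (isKillingOn_of_mem_killing g hK he)
    (isKillingOn_of_mem_killing g hK' he) hk hk'
    (fun z hz ↦ formInChart_eq_metric g he K hz.1)
    (fun z hz ↦ formInChart_eq_metric g he K' hz.1) hB hs hy⟩

/-- The `Λ²`-component of the algebraic bracket of the values of two Killing fields is skew. -/
theorem IsMetricOn.tensorBracket_skew {G : E → E →L[ℝ] E →L[ℝ] ℝ} {s : Set E}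
    (hG : IsMetricOn G s) {y : E} (hy : y ∈ s) {X X' : (E →L[ℝ] ℝ) × (E →L[ℝ] E →L[ℝ] ℝ)}
    (hX : ∀ a b, X.2 a b = -X.2 b a) (hX' : ∀ a b, X'.2 a b = -X'.2 b a) (a b : E) :
    (tensorBracket (curvatureLower G y) (G y) X X').2 a b =
      -(tensorBracket (curvatureLower G y) (G y) X X').2 b a := by
  have hself : ∀ f, G y ((G y).inverse f) = f := (hG.isInvertible y hy).self_apply_inverse
  -- `L'_a{}^c L_{cb} = -L_{bc} L'_a{}^c`, and raising an index is symmetric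
  have key : ∀ (L L' : E →L[ℝ] E →L[ℝ] ℝ), (∀ a b, L a b = -L b a) → ∀ a b,
      L ((G y).inverse (L' a)) b = -L' a ((G y).inverse (L b)) := by
    intro L L' hL a b
    rw [hL]
    have h1 := congrArg (fun f : E →L[ℝ] ℝ ↦ f ((G y).inverse (L' a))) (hself (L b))
    have h2 := congrArg (fun f : E →L[ℝ] ℝ ↦ f ((G y).inverse (L b))) (hself (L' a))
    beta_reduce at h1 h2
    rw [← h1, ← h2, hG.symm y hy]
  change X.2 ((G y).inverse (X'.2 a)) b - X'.2 ((G y).inverse (X.2 a)) b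
      + curvatureLower G y a b _ _ = -(X.2 ((G y).inverse (X'.2 b)) a
      - X'.2 ((G y).inverse (X.2 b)) a + curvatureLower G y b a _ _)
  have k1 := key X.2 X'.2 hX a b
  have k2 := key X'.2 X.2 hX' a b
  rw [curvatureLower_swap_left G y a b, k1, k2, hX' a, hX a]
  ring

/-- The bracket of two Killing fields is Killing, since its covariant derivative is the
`Λ²`-component of an algebraic bracket and therefore skew. -/
theorem fieldBracket_mem_killing {K K' : ∀ p : M, Cotangent E p} (hK : K ∈ killing g U)
    (hK' : K' ∈ killing g U) : fieldBracket g U K K' ∈ killing g U := by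
  refine ⟨fun p hp ↦ ?_, fun p hp ↦ if_neg hp, fun e he y hy hyU a b ↦ ?_⟩
  · have he := IsManifold.chart_mem_maximalAtlas (I := 𝓘(ℝ, E)) (n := ∞) p
    have hpe := mem_chart_source E p
    refine (contMDiffAt_form ((inChart_fieldBracket g hK hK' he).1.contDiffAt
      ((isOpen_chartDomain _ U.isOpen).mem_nhds
        ⟨(chartAt E p).map_source hpe, ?_⟩))).contMDiffWithinAt
    rw [mem_preimage, (chartAt E p).left_inv hpe]
    exact hp
  · have h := congrArg Prod.snd ((inChart_fieldBracket g hK hK' he).2 y ⟨hy, hyU⟩)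
    change covDerivForm _ _ y = _ at h
    rw [h]
    exact (eq_neg_iff_add_eq_zero.1 ((g.isMetricOn_inter he U).tensorBracket_skew ⟨hy, hyU⟩
      ((isKillingOn_of_mem_killing g hK he).covDerivForm_skew ⟨hy, hyU⟩)
      ((isKillingOn_of_mem_killing g hK' he).covDerivForm_skew ⟨hy, hyU⟩) a b))

/-- The map `φ_U`, evaluated at a point, intertwines the Lie bracket of Killing fields with the
algebraic bracket. -/
theorem phi_fieldBracket {K K' : ∀ p : M, Cotangent E p} (hK : K ∈ killing g U)
    (hK' : K' ∈ killing g U) {x : M} (hx : x ∈ U) :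
    phi g U (fieldBracket g U K K') x =
      tensorBracket (riemann g x) (g.val x) (phi g U K x) (phi g U K' x) := by
  have he := IsManifold.chart_mem_maximalAtlas (I := 𝓘(ℝ, E)) (n := ∞) x
  have hxe := mem_chart_source E x
  have hy := (chartAt E x).map_source hxe
  have hyU : chartAt E x x ∈ (chartAt E x).target ∩ (chartAt E x).symm ⁻¹' U :=
    ⟨hy, by rw [mem_preimage, (chartAt E x).left_inv hxe]; exact hx⟩
  have hsurj : Function.Surjective (chartDeriv (chartAt E x) x) :=
    (mdifferentiable_of_mem_maximalAtlas he).mfderiv_surjective hxe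
  have hval := bilin_eq_pullBilin he g.val hxe
  have hinv := g.isInvertible x
  have hphi : ∀ K : ∀ p : M, Cotangent E p, phi g U K x =
      ((formInChart (chartAt E x) K (chartAt E x x)).comp (chartDeriv (chartAt E x) x),
        pullBilin (chartDeriv (chartAt E x) x) (covDerivForm (bilinInChart (chartAt E x) g.val)
          (formInChart (chartAt E x) K) (chartAt E x x))) := fun K ↦ by
    rw [phi_apply g hx, ← form_eq_formInChart_comp he K hxe]
    rfl
  have h := (inChart_fieldBracket g hK hK' he).2 _ hyU
  rw [hval] at hinv
  rw [hphi, hphi, hphi, hval, riemann, tensorBracket_pull hsurj _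
    ((g.isMetricOn he).isInvertible _ hy) hinv
    (formInChart (chartAt E x) K (chartAt E x x), covDerivForm (bilinInChart (chartAt E x) g.val)
          (formInChart (chartAt E x) K) (chartAt E x x))
    (formInChart (chartAt E x) K' (chartAt E x x), covDerivForm (bilinInChart (chartAt E x) g.val)
          (formInChart (chartAt E x) K') (chartAt E x x)), ← h]

theorem isLieBracketOn_fieldBracket (U : Opens M) :
    IsLieBracketOn (fieldBracket g U) (killing g U) := by
  have : IsManifold 𝓘(ℝ, E) 2 M := .of_le (n := ∞) ENat.LEInfty.out
  have : IsManifold 𝓘(ℝ, E) (minSmoothness ℝ 3) M :=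
    .of_le (n := ∞) (by simp; exact ENat.LEInfty.out)
  have : CompleteSpace E := FiniteDimensional.complete ℝ E
  have hs : ∀ {K : ∀ p : M, Cotangent E p}, K ∈ killing g U → ∀ p ∈ U, _ := fun {K} hK p hp ↦
    contMDiffAt_sharp g (K := K) hK.1 hp
  have hd : ∀ {K : ∀ p : M, Cotangent E p}, K ∈ killing g U → ∀ p ∈ U, _ := fun {K} hK p hp ↦
    (hs (K := K) hK p hp).mdifferentiableAt (by simp)
  have hadd : ∀ K K' : ∀ p : M, Cotangent E p, sharp g (K + K') = sharp g K + sharp g K' :=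
    fun K K' ↦ funext fun p ↦ map_add _ _ _
  have hsmul : ∀ (c : ℝ) (K : ∀ p : M, Cotangent E p), sharp g (c • K) = c • sharp g K :=
    fun c K ↦ funext fun p ↦ (g.val p).inverse.map_smul c (K p)
  have hbr : ∀ (K K' : ∀ p : M, Cotangent E p) {p : M}, p ∈ U → fieldBracket g U K K' p =
      g.val p (VectorField.mlieBracket 𝓘(ℝ, E) (sharp g K) (sharp g K') p) :=
    fun K K' p hp ↦ if_pos hp
  have hsbr : ∀ (K K' : ∀ p : M, Cotangent E p) {p : M}, p ∈ U →
      sharp g (fieldBracket g U K K') =ᶠ[𝓝 p]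
        VectorField.mlieBracket 𝓘(ℝ, E) (sharp g K) (sharp g K') := by
    intro K K' p hp
    filter_upwards [U.isOpen.mem_nhds hp] with q hq
    rw [sharp, hbr K K' hq, (g.isInvertible q).inverse_apply_self]
  have hext : ∀ A B : ∀ p : M, Cotangent E p, (∀ p ∉ U, A p = B p) → (∀ p ∈ U, A p = B p) →
      A = B := fun A B h1 h2 ↦ funext fun p ↦ by
    by_cases hp : p ∈ U
    exacts [h2 p hp, h1 p hp]
  have hout : ∀ (K K' : ∀ p : M, Cotangent E p) {p : M}, p ∉ U → fieldBracket g U K K' p = 0 :=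
    fun K K' p hp ↦ if_neg hp
  refine ⟨fun X hX Y hY ↦ fieldBracket_mem_killing g hX hY, fun X hX Y hY Z hZ ↦ ?_,
    fun c X hX Y hY ↦ ?_, fun X hX Y hY Z hZ ↦ ?_, fun c X hX Y hY ↦ ?_, fun X hX ↦ ?_,
    fun X hX Y hY Z hZ ↦ ?_⟩ <;> refine hext _ _ (fun p hp ↦ ?_) (fun p hp ↦ ?_)
  · simp [hout _ _ hp]
  · rw [Pi.add_apply, hbr _ _ hp, hbr _ _ hp, hbr _ _ hp, hadd,
      VectorField.mlieBracket_add_left (hd hX p hp) (hd hY p hp), map_add]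
  · simp [hout _ _ hp]
  · rw [Pi.smul_apply, hbr _ _ hp, hbr _ _ hp, hsmul,
      VectorField.mlieBracket_const_smul_left (hd hX p hp), map_smul]
  · simp [hout _ _ hp]
  · rw [Pi.add_apply, hbr _ _ hp, hbr _ _ hp, hbr _ _ hp, hadd,
      VectorField.mlieBracket_add_right (hd hY p hp) (hd hZ p hp), map_add]
  · simp [hout _ _ hp]
  · rw [Pi.smul_apply, hbr _ _ hp, hbr _ _ hp, hsmul,
      VectorField.mlieBracket_const_smul_right (hd hY p hp), map_smul]
  · simp [hout _ _ hp]
  · rw [hbr _ _ hp, VectorField.mlieBracket_self]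
    simp
  · simp [hout _ _ hp]
  · have h2 : ∀ {K : ∀ p : M, Cotangent E p} (hK : K ∈ killing g U), _ := fun {K} hK ↦
      (hs (K := K) hK p hp).of_le (m := minSmoothness ℝ 2) (by simp; exact ENat.LEInfty.out)
    have hJ := VectorField.leibniz_identity_mlieBracket_apply (h2 hX) (h2 hY) (h2 hZ)
    have e1 := (EventuallyEq.refl (𝓝 p) (sharp g X)).mlieBracket_vectorField_eq (I := 𝓘(ℝ, E))
      (hsbr Y Z hp)
    have e2 := (EventuallyEq.refl (𝓝 p) (sharp g Y)).mlieBracket_vectorField_eq (I := 𝓘(ℝ, E))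
      (hsbr X Z hp)
    have e3 := (EventuallyEq.refl (𝓝 p) (sharp g Z)).mlieBracket_vectorField_eq (I := 𝓘(ℝ, E))
      (hsbr X Y hp)
    have hZX : fieldBracket g U Z X = (-1 : ℝ) • fieldBracket g U X Z := by
      refine hext _ _ (fun q hq ↦ ?_) (fun q hq ↦ ?_)
      · simp [hout _ _ hq]
      · rw [Pi.smul_apply, hbr _ _ hq, hbr _ _ hq, VectorField.mlieBracket_swap_apply, map_neg,
          neg_one_smul]
    rw [Pi.add_apply, Pi.add_apply, hbr _ _ hp, hbr _ _ hp, hbr _ _ hp, e1, e3, hJ, hZX, hsmul,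
      VectorField.mlieBracket_const_smul_right (hd (fieldBracket_mem_killing g hX hZ) p hp), e2,
      neg_one_smul, VectorField.mlieBracket_swap_apply (V := sharp g Z), ← map_add, ← map_add]
    have : ∀ a b : TangentSpace 𝓘(ℝ, E) p, a + b + -b + -a = 0 := fun a b ↦ by abel
    rw [this, map_zero]
    rfl

section Uniqueness

theorem eq_zero_iff_inChart_eq_zero {e : OpenPartialHomeomorph M E}
    (he : e ∈ IsManifold.maximalAtlas 𝓘(ℝ, E) ∞ M) (X : ∀ p : M, Cotangent E p × Bilin E p) {p : M}
    (hp : p ∈ e.source) : X p = 0 ↔ formInChart e (fun p ↦ (X p).1) (e p) = 0 ∧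
      bilinInChart e (fun p ↦ (X p).2) (e p) = 0 := by
  constructor
  · intro h
    constructor
    · ext u
      rw [formInChart_apply_of_eq _ (e.left_inv hp), h]
      rfl
    · ext u v
      rw [bilinInChart_apply_of_eq _ (e.left_inv hp), h]
      rfl
  · rintro ⟨h1, h2⟩
    refine Prod.ext ?_ ?_
    · rw [form_eq_formInChart_comp he (fun p ↦ (X p).1) hp, h1]
      rfl
    · rw [bilin_eq_pullBilin he (fun p ↦ (X p).2) hp, h2]
      rfl

/-- A parallel section over a connected open set is determined by its value at one point. -/
theorem eq_zero_of_mem_parallel (hU : IsPreconnected (U : Set M))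
    {X : ∀ p : M, Cotangent E p × Bilin E p} (hX : X ∈ parallel g U) {x : M} (hx : x ∈ U)
    (hXx : X x = 0) : X = 0 := by
  obtain ⟨hs1, hs2, h0, -, hpar⟩ := hX
  have hzero : ∀ p ∈ U, X p = 0 → ∀ᶠ q in 𝓝 p, X q = 0 := by
    intro p hp hXp
    set e := chartAt E p
    have he : e ∈ IsManifold.maximalAtlas 𝓘(ℝ, E) ∞ M := IsManifold.chart_mem_maximalAtlas p
    have hpe : p ∈ e.source := mem_chart_source E p
    have hev := (g.isMetricOn_inter he U).eventually_eq_zero_of_parallel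
      (hs1.contDiffOn U.isOpen he) (hs2.contDiffOn U.isOpen he)
      (fun z hz ↦ (hpar e he z hz.1 hz.2).1) (fun z hz ↦ (hpar e he z hz.1 hz.2).2)
      (y := e p) ⟨e.map_source hpe, by rw [mem_preimage, e.left_inv hpe]; exact hp⟩
      ((eq_zero_iff_inChart_eq_zero he X hpe).1 hXp).1
      ((eq_zero_iff_inChart_eq_zero he X hpe).1 hXp).2
    filter_upwards [e.open_source.mem_nhds hpe, (e.continuousAt hpe).eventually hev] with q hq hq'
      using (eq_zero_iff_inChart_eq_zero he X hq).2 hq'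
  have hnonzero : ∀ p ∈ U, X p ≠ 0 → ∀ᶠ q in 𝓝 p, X q ≠ 0 := by
    intro p hp hXp
    set e := chartAt E p
    have he : e ∈ IsManifold.maximalAtlas 𝓘(ℝ, E) ∞ M := IsManifold.chart_mem_maximalAtlas p
    have hpe : p ∈ e.source := mem_chart_source E p
    have hy := e.map_source hpe
    have hyU : e.symm (e p) ∈ U := by rw [e.left_inv hpe]; exact hp
    rw [Ne, eq_zero_iff_inChart_eq_zero he X hpe, not_and_or] at hXp
    rcases hXp with h | h
    · have hc := (hs1.differentiableAt U.isOpen he hy hyU).continuousAt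
      filter_upwards [e.open_source.mem_nhds hpe,
        (e.continuousAt hpe).eventually (hc.eventually_ne h)] with q hq hq' hXq
        using hq' ((eq_zero_iff_inChart_eq_zero he X hq).1 hXq).1
    · have hc := (hs2.differentiableAt U.isOpen he hy hyU).continuousAt
      filter_upwards [e.open_source.mem_nhds hpe,
        (e.continuousAt hpe).eventually (hc.eventually_ne h)] with q hq hq' hXq
        using hq' ((eq_zero_iff_inChart_eq_zero he X hq).1 hXq).2
  -- by `hzero` and `hnonzero`, the interiors of the zero set and of its complement cover `U`
  have hsub := hU.subset_left_of_subset_union (u := {p | ∀ᶠ q in 𝓝 p, X q = 0})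
    (v := {p | ∀ᶠ q in 𝓝 p, X q ≠ 0}) isOpen_setOfPred_eventually_nhds
    isOpen_setOfPred_eventually_nhds
    (disjoint_left.2 fun p h1 h2 ↦ h2.self_of_nhds h1.self_of_nhds)
    (fun p hp ↦ (em (X p = 0)).imp (hzero p hp) (hnonzero p hp)) ⟨x, hx, hzero x hx hXx⟩
  funext p
  by_cases hp : p ∈ U
  exacts [(hsub hp).self_of_nhds, h0 p hp]

end Uniqueness

/-- The map `K ↦ K_a(x) + K_{a;b}(x)` from Killing fields to values of parallel sections. -/
noncomputable def evalPhi (U : Opens M) {x : M} (hx : x ∈ U) :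
    killing g U →ₗ[ℝ] parallelValues g U x where
  toFun K := ⟨phi g U K x, phi g U K, phi_mem_parallel g K.2, rfl⟩
  map_add' K K' := Subtype.ext <| by
    change phi g U (K + K' : ∀ p : M, Cotangent E p) x = phi g U K x + phi g U K' x
    have he := IsManifold.chart_mem_maximalAtlas (I := 𝓘(ℝ, E)) (n := ∞) x
    have hxe := mem_chart_source E x
    have hyU : (chartAt E x).symm (chartAt E x x) ∈ U := by
      rw [(chartAt E x).left_inv hxe]; exact hx
    have hd := fun K : killing g U ↦
      K.2.1.differentiableAt U.isOpen he ((chartAt E x).map_source hxe) hyU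
    rw [phi_apply g hx, phi_apply g hx, phi_apply g hx]
    refine Prod.ext rfl ?_
    ext a b
    exact covDerivForm_add _ (hd K) (hd K') _ _
  map_smul' c K := Subtype.ext <| by
    change phi g U (c • K : ∀ p : M, Cotangent E p) x = c • phi g U K x
    have he := IsManifold.chart_mem_maximalAtlas (I := 𝓘(ℝ, E)) (n := ∞) x
    have hxe := mem_chart_source E x
    have hyU : (chartAt E x).symm (chartAt E x x) ∈ U := by
      rw [(chartAt E x).left_inv hxe]; exact hx
    rw [phi_apply g hx, phi_apply g hx]
    refine Prod.ext rfl ?_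
    ext a b
    exact covDerivForm_smul _ c
      (K.2.1.differentiableAt U.isOpen he ((chartAt E x).map_source hxe) hyU) _ _

theorem evalPhi_bijective (hU : IsPreconnected (U : Set M)) {x : M} (hx : x ∈ U) :
    Function.Bijective (evalPhi g U hx) := by
  constructor
  · rw [injective_iff_map_eq_zero]
    intro K hK
    have h0 := eq_zero_of_mem_parallel g hU (phi_mem_parallel g K.2) hx (congrArg Subtype.val hK)
    refine Subtype.ext (funext fun p ↦ ?_)
    by_cases hp : p ∈ U
    · have := congrFun h0 p
      rw [phi_apply g hp] at this
      exact congrArg Prod.fst this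
    · exact K.2.2.1 p hp
  · rintro ⟨w, X, hX, rfl⟩
    obtain ⟨hK, hphi⟩ := exists_killing_of_mem_parallel g hX
    exact ⟨⟨_, hK⟩, Subtype.ext (congrFun hphi x)⟩

end Correspondence

/-! ### Transport of Lie brackets -/

section Transport

variable {P Q : Type*} [AddCommGroup P] [Module ℝ P] [AddCommGroup Q] [Module ℝ Q]
  {br : P → P → P} {br' : Q → Q → Q} {S : Submodule ℝ P} {T : Submodule ℝ Q}

/-- A Lie bracket is carried along a surjective linear map that intertwines it with another
operation. -/
theorem IsLieBracketOn.of_surjective (h : IsLieBracketOn br S) (f : S →ₗ[ℝ] T)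
    (hf : Function.Surjective f)
    (hbr : ∀ K K' : S, br' (f K) (f K') = f ⟨br K K', h.mem _ K.2 _ K'.2⟩) :
    IsLieBracketOn br' T := by
  have hex : ∀ X ∈ T, ∃ K : S, (f K : Q) = X := fun X hX ↦
    (hf ⟨X, hX⟩).imp fun K hK ↦ congrArg Subtype.val hK
  refine ⟨fun X hX Y hY ↦ ?_, fun X hX Y hY Z hZ ↦ ?_, fun c X hX Y hY ↦ ?_,
    fun X hX Y hY Z hZ ↦ ?_, fun c X hX Y hY ↦ ?_, fun X hX ↦ ?_, fun X hX Y hY Z hZ ↦ ?_⟩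
  · obtain ⟨K, rfl⟩ := hex X hX
    obtain ⟨K', rfl⟩ := hex Y hY
    rw [hbr]
    exact (f _).2
  · obtain ⟨K, rfl⟩ := hex X hX
    obtain ⟨K', rfl⟩ := hex Y hY
    obtain ⟨K'', rfl⟩ := hex Z hZ
    rw [← Submodule.coe_add, ← map_add, hbr, hbr, hbr, ← Submodule.coe_add, ← map_add]
    congr 2
    exact Subtype.ext (h.add_left _ K.2 _ K'.2 _ K''.2)
  · obtain ⟨K, rfl⟩ := hex X hX
    obtain ⟨K', rfl⟩ := hex Y hY
    rw [← Submodule.coe_smul, ← map_smul, hbr, hbr, ← Submodule.coe_smul, ← map_smul]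
    congr 2
    exact Subtype.ext (h.smul_left c _ K.2 _ K'.2)
  · obtain ⟨K, rfl⟩ := hex X hX
    obtain ⟨K', rfl⟩ := hex Y hY
    obtain ⟨K'', rfl⟩ := hex Z hZ
    rw [← Submodule.coe_add, ← map_add, hbr, hbr, hbr, ← Submodule.coe_add, ← map_add]
    congr 2
    exact Subtype.ext (h.add_right _ K.2 _ K'.2 _ K''.2)
  · obtain ⟨K, rfl⟩ := hex X hX
    obtain ⟨K', rfl⟩ := hex Y hY
    rw [← Submodule.coe_smul, ← map_smul, hbr, hbr, ← Submodule.coe_smul, ← map_smul]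
    congr 2
    exact Subtype.ext (h.smul_right c _ K.2 _ K'.2)
  · obtain ⟨K, rfl⟩ := hex X hX
    rw [hbr, show (⟨br K K, _⟩ : S) = 0 from Subtype.ext (h.self _ K.2), map_zero]
    rfl
  · obtain ⟨K, rfl⟩ := hex X hX
    obtain ⟨K', rfl⟩ := hex Y hY
    obtain ⟨K'', rfl⟩ := hex Z hZ
    rw [hbr, hbr, hbr, hbr, hbr, hbr, ← Submodule.coe_add, ← map_add, ← Submodule.coe_add,
      ← map_add]
    refine (congrArg (fun K : S ↦ (f K : Q)) (Subtype.ext (h.jacobi _ K.2 _ K'.2 _ K''.2) :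
      _ = (0 : S))).trans ?_
    rw [map_zero]
    rfl

end Transport

end KillingFields

/-! ### The isomorphism of Lie algebras -/

theorem mainTheorem5 {E : Type*} [NormedAddCommGroup E] [NormedSpace ℝ E] [FiniteDimensional ℝ E]
    {M : Type*} [TopologicalSpace M] [ChartedSpace E M] [IsManifold 𝓘(ℝ, E) ∞ M]
    (g : KillingFields.PseudoRiemannianMetric E M) (U : TopologicalSpace.Opens M)
    (hU : IsConnected (U : Set M)) (x : M) (hx : x ∈ U) :
    (∀ K ∈ KillingFields.killing g U, KillingFields.phi g U K ∈ KillingFields.parallel g U) ∧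
    ∃ (hK : KillingFields.IsLieBracketOn (KillingFields.fieldBracket g U)
          (KillingFields.killing g U))
      (hW : KillingFields.IsLieBracketOn
          (KillingFields.tensorBracket (KillingFields.riemann g x) (g.val x))
          (KillingFields.parallelValues g U x))
      (Φ : hK.LieAlg ≃ₗ⁅ℝ⁆ hW.LieAlg),
      ∀ K : hK.LieAlg, hW.val (Φ K) = KillingFields.phi g U (hK.val K) x := by
  have hK := KillingFields.isLieBracketOn_fieldBracket g U
  have hbij := KillingFields.evalPhi_bijective g hU.isPreconnected hx
  have hbr : ∀ K K' : KillingFields.killing g U,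
      KillingFields.tensorBracket (KillingFields.riemann g x) (g.val x)
        (KillingFields.evalPhi g U hx K) (KillingFields.evalPhi g U hx K') =
      KillingFields.evalPhi g U hx ⟨KillingFields.fieldBracket g U K K', hK.mem _ K.2 _ K'.2⟩ :=
    fun K K' ↦ (KillingFields.phi_fieldBracket g K.2 K'.2 hx).symm
  have hW := hK.of_surjective (KillingFields.evalPhi g U hx) hbij.2 hbr
  let Ψ : hK.LieAlg ≃ₗ[ℝ] hW.LieAlg :=
    LinearEquiv.ofBijective (KillingFields.evalPhi g U hx) hbij
  refine ⟨fun K hK ↦ KillingFields.phi_mem_parallel g hK, hK, hW,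
    { Ψ with map_lie' := fun {K K'} ↦ Subtype.ext (hbr K K').symm }, fun K ↦ rfl⟩
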